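/- Let $(X,d)$ be a compact metric space with a base point $\bullet\in X$, and let $R>0$ be such that every open ball of $X$ of positive radius less than $R$ is simply connected. For $c\ge 0$ let $\mathcal M_c$ be the set of unordered pairs $\{x,y\}$ of points of $X$ with $d(x,y)=c$ such that $d\colon X\times X\to[0,\infty)$ has a local minimum at $(x,y)$, and let $\mathrm{LocMin}(d)=\{c\ge 0 \mid \mathcal M_c\neq\emptyset\}$. Assume that $\mathrm{LocMin}(d)$ is finite and that $\mathcal M_c$ is finite for every $c>0$. For $r>0$ let $\mathrm{Rips}(X,r)$ be the geometric realization (with the weak topology) of the abstract simplicial complex whose simplices are the non-empty finite subsets of $X$ of diameter less than $r$. Let $A$ be a commutative ring, let $H_1(-)$ denote singular homology with coefficients in $A$, and let $\operatorname{mgs}$ denote the least cardinality of a generating set, of an $A$-module in the case of $H_1$ (for $A=\mathbb Z$: of an abelian group), and of a group in the case of $\pi_1$. For a space $K$ let $\mathrm{MGS}(K)=\sum_j \operatorname{mgs}(\pi_1(K_j,x_j))$, where $K_j$ runs through the path components of $K$ and $x_j\in K_j$. Then for every $r>0$: $$\operatorname{mgs}(H_1(\mathrm{Rips}(X,r)))\le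 \operatorname{mgs}(H_1(X))+\sum_{0<c<r}|\mathcal M_c|<\infty,$$ $$\mathrm{MGS}(\mathrm{Rips}(X,r))\le \mathrm{MGS}(X)+\sum_{0<c<r}|\mathcal M_c|<\infty,$$ and in particular $$\operatorname{mgs}(\pi_1(\mathrm{Rips}(X,r),\bullet))\le \mathrm{MGS}(X)+\sum_{0<c<r}|\mathcal M_c|<\infty,$$ the sums running over the finitely many $c\in\mathrm{LocMin}(d)$ with $0<c<r$. -/

import Mathlib

universe u v

noncomputable section

namespace RipsMin

section Realization

variable {ι : Type u}

/-- The underlying set of the geometric realization of an abstract simplicial complex `K`: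
the finitely supported families of barycentric coordinates `f : ι →₀ ℝ`, non-negative and with
sum `1`, whose support is a simplex of `K`. -/
def Realization (K : PreAbstractSimplicialComplex ι) : Type u :=
  {f : ι →₀ ℝ // f.support ∈ K.faces ∧ (∀ i, 0 ≤ f i) ∧ (f.sum fun _ a => a) = 1}

/-- The family of barycentric coordinates of a point of a closed simplex `s`,
extended by zero outside `s`. -/
def extendCoord (s : Finset ι) (g : s → ℝ) : ι →₀ ℝ :=
  Finsupp.embDomain (Function.Embedding.subtype (· ∈ s)) (Finsupp.equivFunOnFinite.symm g)

theorem extendCoord_sum (s : Finset ι) (g : s → ℝ) :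
    ((extendCoord s g).sum fun _ a => a) = ∑ i, g i := by
  classical
  rw [extendCoord, Finsupp.sum_embDomain, Finsupp.sum_fintype _ _ (fun _ => rfl)]
  simp

theorem extendCoord_support_subset (s : Finset ι) (g : s → ℝ) :
    (extendCoord s g).support ⊆ s := by
  intro i hi
  rw [extendCoord, Finsupp.support_embDomain, Finset.mem_map] at hi
  obtain ⟨a, _, rfl⟩ := hi
  exact a.2

theorem extendCoord_nonneg (s : Finset ι) (g : s → ℝ) (hg : ∀ i, 0 ≤ g i) (i : ι) :
    0 ≤ extendCoord s g i := by
  by_cases hi : i ∈ s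
  · have h : extendCoord s g ((Function.Embedding.subtype (· ∈ s)) ⟨i, hi⟩) = g ⟨i, hi⟩ := by
      rw [extendCoord, Finsupp.embDomain_apply_self]
      rfl
    exact h.symm ▸ hg ⟨i, hi⟩
  · have h : i ∉ (extendCoord s g).support := fun h => hi (extendCoord_support_subset s g h)
    rw [Finsupp.notMem_support_iff] at h
    exact h.ge

/-- The inclusion into the realization of `K` of the closed simplex spanned by a face `s`. -/
def simplexMap (K : PreAbstractSimplicialComplex ι) (s : K.faces) (g : stdSimplex ℝ (s : Finset ι)) :
    Realization K :=
  ⟨extendCoord s g, by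
    have hsum : ((extendCoord (s : Finset ι) g).sum fun _ a => a) = 1 := by
      rw [extendCoord_sum]
      exact g.2.2
    refine ⟨(K.isRelLowerSet_faces s.2).2 (extendCoord_support_subset _ _) ?_,
      extendCoord_nonneg _ _ g.2.1, hsum⟩
    by_contra h
    rw [Finset.not_nonempty_iff_eq_empty] at h
    simp [Finsupp.sum, h] at hsum⟩

/-- The weak (coherent) topology on the realization of `K`: a set is open if and only if its
preimage in every closed simplex is open. -/
instance (K : PreAbstractSimplicialComplex ι) : TopologicalSpace (Realization K) :=
  ⨆ s : K.faces, TopologicalSpace.coinduced (simplexMap K s) inferInstance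

/-- The point of the realization given by a vertex `x` of `K`. -/
def vertex (K : PreAbstractSimplicialComplex ι) (x : ι) (hx : {x} ∈ K.faces) : Realization K :=
  ⟨Finsupp.single x 1, by
    refine ⟨?_, fun i => ?_, by simp⟩
    · rwa [Finsupp.support_single _ one_ne_zero]
    · classical
      rw [Finsupp.single_apply]
      split_ifs <;> simp⟩

end Realization

section Rips

variable (X : Type u) [MetricSpace X]

/-- The open Rips complex: its simplices are the non-empty finite subsets of `X` of diameter
less than `r`. -/
def Rips (r : ℝ) : PreAbstractSimplicialComplex X where
  faces := {s | s.Nonempty ∧ Metric.diam (s : Set X) < r}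
  isRelLowerSet_faces := fun s hs => ⟨hs.1, fun _ hts ht =>
    ⟨ht, (Metric.diam_mono (Finset.coe_subset.2 hts) s.finite_toSet.isBounded).trans_lt hs.2⟩⟩

theorem singleton_mem_rips {r : ℝ} (hr : 0 < r) (x : X) : {x} ∈ (Rips X r).faces :=
  ⟨Finset.singleton_nonempty x, by simpa using hr⟩

/-- The geometric realization of the open Rips complex. -/
abbrev RipsSpace (r : ℝ) : Type u := Realization (Rips X r)

/-- The point of the realized Rips complex given by a point of `X`. -/
def ripsPoint {r : ℝ} (hr : 0 < r) (x : X) : RipsSpace X r :=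
  vertex (Rips X r) x (singleton_mem_rips X hr x)

/-- The pairs `(x, y)` with `d(x, y) = c` at which the distance function `d : X × X → ℝ` has a
local minimum. -/
def minPairs (c : ℝ) : Set (X × X) :=
  {p | dist p.1 p.2 = c ∧ IsLocalMin (fun q : X × X => dist q.1 q.2) p}

/-- The same pairs as unordered pairs, that is, as the edges `⟨x, y⟩` which they span. -/
def minEdges (c : ℝ) : Set (Sym2 X) :=
  (fun p : X × X => s(p.1, p.2)) '' minPairs X c

/-- The set of local minima (i.e. local minimum values) of the distance function. -/
def LocMin : Set ℝ := {c | (minPairs X c).Nonempty}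

/-- The total number of edges at which the distance function has a local minimum with value in the
open interval `(0, r)`. The value `0` is left out, its local minima being the points `(x, x)`. -/
def numMinEdges (hmin : (LocMin X).Finite) (r : ℝ) : ℕ∞ :=
  ∑ c ∈ hmin.toFinset with 0 < c ∧ c < r, (minEdges X c).encard

/-- All open balls of positive radius less than `R` are simply connected. -/
def SimplyConnectedUpTo (R : ℝ) : Prop :=
  ∀ (x : X) (r : ℝ), 0 < r → r < R → IsSimplyConnected (Metric.ball x r)

end Rips

section Invariants

/-- The least cardinality of a generating set of a group (`⊤` if it is not finitely generated). -/
def mgs (G : Type u) [Group G] : ℕ∞ :=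
  ⨅ (S : Set G) (_ : Subgroup.closure S = ⊤), S.encard

/-- The least cardinality of a generating set of a module (`⊤` if it is not finitely generated).
Over `ℤ` this is the least cardinality of a generating set of the underlying abelian group. -/
def mgsModule (A : Type v) [CommRing A] (M : Type u) [AddCommGroup M] [Module A M] : ℕ∞ :=
  ⨅ (S : Set M) (_ : Submodule.span A S = ⊤), S.encard

/-- The first singular homology module of a space, with coefficients in a commutative ring. -/
abbrev H1 (A : Type v) [CommRing A] (Y : Type u) [TopologicalSpace Y] : ModuleCat.{max u v} A :=
  ((AlgebraicTopology.singularHomologyFunctor (ModuleCat.{max u v} A) 1).obj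
    (ModuleCat.of A (ULift.{u} A))).obj (TopCat.of Y)

/-- The sum over the path components of `Y` of the least numbers of generators of their
fundamental groups, each taken at a base point chosen in the component (its choice does not matter). -/
def MGS (Y : Type u) [TopologicalSpace Y] : ℕ∞ :=
  ∑' j : ZerothHomotopy Y, mgs (FundamentalGroup Y (Quotient.out j))

end Invariants

end RipsMin

end

/-!
Map `X` to its Rips complex `K` by a partition of unity so fine that every vertex `x` lies in a
common simplex with the image of the point `x`, and join the two by the straight path in this
simplex, the spoke of `x`. Along the spokes, an edge of `K` between nearby points is homotopic
to the image of a path in `X`. Hence an edge `xy` is generated by paths of `X` and given path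
classes if and only if the edges near `xy` are. If some edge were not generated, then by
compactness the closure of the set of non-generated edges would have a shortest element; it
would not be generated either, and it would be a local minimum of `d`, since all edges near it
are non-generated. So the paths of `X` and the edges at the local minima of `d` generate all
path classes of `K`.

It remains to count. A path class between the images of two points of `X` either merges two path
components or contributes one generator, so it raises the number of generators of `π₁`, summed
over the components, by at most one, and likewise for `H₁`. The same count, for the inclusion of
a finite net of `X` instead of the map to `K`, shows that `π₁` and `H₁` of `X` are finitely
generated.
-/

noncomputable section

namespace RipsMin

open CategoryTheory Path Set Simplicial Topology unitInterval

section PathClasses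

variable {Y : Type*} [TopologicalSpace Y] {a b c : Y}

@[simp]
theorem symm_symm_class (p : Homotopic.Quotient a b) : p.symm.symm = p := by
  induction p with | mk p =>
  rw [← Homotopic.Quotient.mk_symm, ← Homotopic.Quotient.mk_symm, p.symm_symm]

@[simp]
theorem symm_trans_class (p : Homotopic.Quotient a b) (q : Homotopic.Quotient b c) :
    (p.trans q).symm = q.symm.trans p.symm := by
  induction p with | mk p =>
  induction q with | mk q =>
  simp only [← Homotopic.Quotient.mk_symm, ← Homotopic.Quotient.mk_trans, Path.trans_symm]

@[simp]
theorem symm_trans_trans (p : Homotopic.Quotient a b) (q : Homotopic.Quotient b c) :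
    p.symm.trans (p.trans q) = q := by
  rw [← Homotopic.Quotient.trans_assoc, Homotopic.Quotient.symm_trans,
    Homotopic.Quotient.refl_trans]

@[simp]
theorem trans_symm_trans (p : Homotopic.Quotient a b) (q : Homotopic.Quotient a c) :
    p.trans (p.symm.trans q) = q := by
  rw [← Homotopic.Quotient.trans_assoc, Homotopic.Quotient.trans_symm,
    Homotopic.Quotient.refl_trans]

variable {X : Type*} [TopologicalSpace X] (φ : C(Y, X))

theorem map_trans_class (p : Homotopic.Quotient a b) (q : Homotopic.Quotient b c) :
    (p.trans q).map φ = (p.map φ).trans (q.map φ) := by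
  induction p with | mk p =>
  induction q with | mk q =>
  simp only [← Homotopic.Quotient.mk_map, ← Homotopic.Quotient.mk_trans, Path.map_trans]

theorem map_symm_class (p : Homotopic.Quotient a b) : p.symm.map φ = (p.map φ).symm := by
  induction p with | mk p => rfl

theorem joined_of_pathClass (p : Homotopic.Quotient a b) : Joined a b := by
  induction p with | mk p => exact ⟨p⟩

end PathClasses

section Subgroupoids

variable {Y : Type*} [TopologicalSpace Y]

/-- The fundamental groupoid of `Y` on a family `w` of base points (R. Brown): its objects are the
indices, and its arrows `i ⟶ j` are the classes of paths from `w i` to `w j`. -/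
def FundamentalGroupoidOn {J : Type*} (_ : J → Y) : Type _ := J

instance {J : Type*} (w : J → Y) : Groupoid (FundamentalGroupoidOn w) where
  Hom i j := Homotopic.Quotient (w i) (w j)
  id i := Homotopic.Quotient.refl (w i)
  comp p q := p.trans q
  inv p := p.symm
  id_comp := Homotopic.Quotient.refl_trans
  comp_id := Homotopic.Quotient.trans_refl
  assoc := Homotopic.Quotient.trans_assoc
  inv_comp := Homotopic.Quotient.symm_trans
  comp_inv := Homotopic.Quotient.trans_symm

theorem cast_mem_arrows_iff (S : Subgroupoid (FundamentalGroupoid Y)) {a b a' b' : Y}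
    (ha : a' = a) (hb : b' = b) (p : Homotopic.Quotient a b) :
    p.cast ha hb ∈ S.arrows ⟨a'⟩ ⟨b'⟩ ↔ p ∈ S.arrows ⟨a⟩ ⟨b⟩ := by
  subst ha hb
  rw [p.cast_rfl_rfl]

theorem fundamentalGroupoid_eq_top_of_openCover {ι : Type*} {U : ι → Set Y}
    (hU : ∀ i, IsOpen (U i)) (hcov : ∀ y, ∃ i, y ∈ U i) (S : Subgroupoid (FundamentalGroupoid Y))
    (hS : ∀ i (a b : Y) (p : Path a b), range p ⊆ U i →
      Homotopic.Quotient.mk p ∈ S.arrows ⟨a⟩ ⟨b⟩) : S = ⊤ := by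
  refine top_unique ((Subgroupoid.le_iff _ _).2 fun {a b} γ _ => ?_)
  obtain ⟨a⟩ := a
  obtain ⟨b⟩ := b
  obtain ⟨γ, rfl⟩ := Homotopic.Quotient.mk_surjective γ
  obtain ⟨t, t_zero, t_mono, ⟨N, t_eq_one⟩, ht⟩ :=
    exists_monotone_Icc_subset_open_cover_unitInterval (c := fun i => γ ⁻¹' U i)
      (fun i => (hU i).preimage γ.continuous) fun s _ => mem_iUnion.2 (hcov (γ s))
  have subpath_mem (n : ℕ) :
      Homotopic.Quotient.mk (γ.subpath 0 (t n)) ∈ S.arrows ⟨γ 0⟩ ⟨γ (t n)⟩ := by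
    induction n with
    | zero =>
      obtain ⟨i, hi⟩ := hcov (γ 0)
      rw [t_zero, Path.subpath_self]
      exact hS i _ _ _ (by simpa using hi)
    | succ n ih =>
      obtain ⟨i, hi⟩ := ht n
      have hstep := hS i _ _ (γ.subpath (t n) (t (n + 1))) (by
        rw [Path.range_subpath_of_le _ _ _ (t_mono n.le_succ)]
        exact image_subset_iff.2 hi)
      have hsub := Homotopic.Quotient.eq.2 ⟨Path.Homotopy.subpathTransSubpath γ 0 (t n) (t (n + 1))⟩
      rw [← hsub]
      exact S.mul ih hstep
  have h := subpath_mem N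
  rwa [t_eq_one N le_rfl, Path.subpath_zero_one, Homotopic.Quotient.mk_cast,
    cast_mem_arrows_iff] at h

namespace FundamentalGroupoidOn

variable {J : Type*} {w : J → Y} {S : Subgroupoid (FundamentalGroupoidOn w)} {i j k : J}

theorem trans_mem {p : Homotopic.Quotient (w i) (w j)} {q : Homotopic.Quotient (w j) (w k)}
    (hp : p ∈ S.arrows i j) (hq : q ∈ S.arrows j k) : p.trans q ∈ S.arrows i k :=
  S.mul hp hq

theorem symm_mem {p : Homotopic.Quotient (w i) (w j)} (hp : p ∈ S.arrows i j) :
    p.symm ∈ S.arrows j i :=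
  S.inv hp

variable (S) {U : J → Set Y}

/-- The classes of paths in `Y` which a subgroupoid `S` contains once they are prolonged to base
points inside the members `U i` of a cover, in any possible way. It reduces generation on the base
points `w i` to generation on all of `Y`. -/
def prolong (hcov : ∀ y, ∃ i, y ∈ U i) (hconn : ∀ i, IsPathConnected (U i))
    (hw : ∀ i, w i ∈ U i) : Subgroupoid (FundamentalGroupoid Y) where
  arrows a b := {p | ∀ (i j : J) (α : Path (w i) a.as) (β : Path b.as (w j)), range α ⊆ U i →
    range β ⊆ U j → ((Homotopic.Quotient.mk α).trans p).trans (Homotopic.Quotient.mk β) ∈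
      S.arrows i j}
  inv {a b p} hp i j α β hα hβ := by
    have h := symm_mem (hp j i β.symm α.symm (by rwa [Path.symm_range]) (by rwa [Path.symm_range]))
    change ((Homotopic.Quotient.mk α).trans (Homotopic.Quotient.symm p)).trans _ ∈ _
    simpa [Homotopic.Quotient.trans_assoc] using h
  mul {a b c p} hp {q} hq i j α β hα hβ := by
    obtain ⟨l, hl⟩ := hcov b.as
    obtain ⟨δ, hδ⟩ := (hconn l).joinedIn _ (hw l) _ hl
    have hδ := range_subset_iff.2 hδ
    have h := trans_mem (hp i l α δ.symm hα (by rwa [Path.symm_range])) (hq l j δ β hδ hβ)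
    change ((Homotopic.Quotient.mk α).trans (Homotopic.Quotient.trans p q)).trans _ ∈ _
    simpa [Homotopic.Quotient.trans_assoc] using h

theorem eq_top_of_openCover (hU : ∀ i, IsOpen (U i)) (hcov : ∀ y, ∃ i, y ∈ U i)
    (hconn : ∀ i, IsPathConnected (U i)) (hw : ∀ i, w i ∈ U i)
    (hS : ∀ (i j : J) (y : Y) (α : Path (w i) y) (β : Path y (w j)), range α ⊆ U i →
      range β ⊆ U j → (Homotopic.Quotient.mk α).trans (Homotopic.Quotient.mk β) ∈ S.arrows i j) :
    S = ⊤ := by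
  have prolong_eq_top : prolong S hcov hconn hw = ⊤ := by
    refine fundamentalGroupoid_eq_top_of_openCover hU hcov _ fun l a b p hp i j α β hα hβ => ?_
    obtain ⟨δ, hδ⟩ := (hconn l).joinedIn _ (hw l) a (hp ⟨0, p.source⟩)
    have hδ := range_subset_iff.2 hδ
    have h := trans_mem (hS i l a α δ.symm hα (by rwa [Path.symm_range]))
      (hS l j b (δ.trans p) β (by rw [Path.trans_range]; exact union_subset hδ hp) hβ)
    simpa [Homotopic.Quotient.trans_assoc] using h
  refine top_unique ((Subgroupoid.le_iff _ _).2 fun {i j} γ _ => ?_)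
  have hγ : (γ : Homotopic.Quotient (w i) (w j)) ∈
      (prolong S hcov hconn hw).arrows ⟨w i⟩ ⟨w j⟩ := by
    rw [prolong_eq_top]
    exact Subgroupoid.mem_top _
  have h := hγ i j (Path.refl _) (Path.refl _) (by simpa using hw i) (by simpa using hw j)
  simpa using h

end FundamentalGroupoidOn

end Subgroupoids

section Squares

variable {Y : Type*} [TopologicalSpace Y]

theorem trans_eq_trans_of_square {a b c d : Y} (H : C(I × I, Y)) (p : Path a b) (q : Path c d)
    (l : Path a c) (r : Path b d) (hp : ∀ t, H (t, 0) = p t) (hq : ∀ t, H (t, 1) = q t)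
    (hl : ∀ s, H (0, s) = l s) (hr : ∀ s, H (1, s) = r s) :
    (Homotopic.Quotient.mk p).trans (Homotopic.Quotient.mk r) =
      (Homotopic.Quotient.mk l).trans (Homotopic.Quotient.mk q) := by
  obtain rfl : H (0, 0) = a := by simp [hp]
  obtain rfl : H (1, 0) = b := by simp [hp]
  obtain rfl : H (0, 1) = c := by simp [hq]
  obtain rfl : H (1, 1) = d := by simp [hq]
  let p' : Path ((0, 0) : I × I) (1, 0) := ⟨⟨fun t => (t, 0), by fun_prop⟩, rfl, rfl⟩
  let q' : Path ((0, 1) : I × I) (1, 1) := ⟨⟨fun t => (t, 1), by fun_prop⟩, rfl, rfl⟩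
  let l' : Path ((0, 0) : I × I) (0, 1) := ⟨⟨fun s => (0, s), by fun_prop⟩, rfl, rfl⟩
  let r' : Path ((1, 0) : I × I) (1, 1) := ⟨⟨fun s => (1, s), by fun_prop⟩, rfl, rfl⟩
  have hp' : p = p'.map H.continuous := by ext t; simp [← hp, p']
  have hq' : q = q'.map H.continuous := by ext t; simp [← hq, q']
  have hl' : l = l'.map H.continuous := by ext s; simp [← hl, l']
  have hr' : r = r'.map H.continuous := by ext s; simp [← hr, r']
  have : ContractibleSpace I := (convex_Icc (0 : ℝ) 1).contractibleSpace ⟨0, by simp⟩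
  have homotopic := (SimplyConnectedSpace.paths_homotopic (p'.trans r') (l'.trans q')).map H
  rw [Path.map_trans, Path.map_trans, ← hp', ← hq', ← hl', ← hr'] at homotopic
  exact Homotopic.Quotient.eq.2 homotopic

end Squares

section SingularChains

variable (A : Type v) [CommRing A] (Y : Type u) [TopologicalSpace Y]

/-- The singular chain complex of `Y` with coefficients in `A`. -/
abbrev singularChains : ChainComplex (ModuleCat.{max u v} A) ℕ :=
  (TopCat.toSSet.obj (TopCat.of Y)).chainComplex (ModuleCat.of A (ULift.{u} A))

/-- The singular `1`-chains modulo boundaries. -/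
abbrev chainsModBoundaries : ModuleCat.{max u v} A := (singularChains A Y).opcycles 1

variable {Y}

/-- The generator of the singular chains given by a singular simplex. -/
def simplexChain {n : ℕ} (f : C(stdSimplex ℝ (Fin (n + 1)), Y)) : (singularChains A Y).X n :=
  ((TopCat.toSSet.obj (TopCat.of Y)).ιChainComplex (R := ModuleCat.of A (ULift.{u} A))
    ((TopCat.toSSetObjEquiv (TopCat.of Y) (.op ⦋n⦌)).symm f)).hom (ULift.up 1)

/-- The `i`-th face of a singular simplex. -/
def face {n : ℕ} (i : Fin (n + 2)) (f : C(stdSimplex ℝ (Fin (n + 2)), Y)) :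
    C(stdSimplex ℝ (Fin (n + 1)), Y) :=
  f.comp ⟨stdSimplex.map i.succAbove, stdSimplex.continuous_map _⟩

theorem face_apply {n : ℕ} (i : Fin (n + 2)) (f : C(stdSimplex ℝ (Fin (n + 2)), Y))
    (b : stdSimplex ℝ (Fin (n + 1))) : face i f b = f (stdSimplex.map i.succAbove b) := rfl

theorem d_simplexChain {n : ℕ} (f : C(stdSimplex ℝ (Fin (n + 2)), Y)) :
    ((singularChains A Y).d (n + 1) n).hom (simplexChain A f) =
      ∑ i : Fin (n + 2), (-1 : ℤ) ^ (i : ℕ) • simplexChain A (face i f) := by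
  have h := congrArg (fun g => g.hom (ULift.up 1)) <|
    (TopCat.toSSet.obj (TopCat.of Y)).ιChainComplex_d (R := ModuleCat.of A (ULift.{u} A))
      ((TopCat.toSSetObjEquiv (TopCat.of Y) (.op ⦋n + 1⦌)).symm f)
  simp only [ModuleCat.hom_comp, LinearMap.comp_apply, ModuleCat.hom_sum, LinearMap.sum_apply,
    ModuleCat.hom_zsmul, LinearMap.smul_apply] at h
  exact h

theorem exists_linearMap_simplexChain {n : ℕ} {M : ModuleCat.{max u v} A}
    (t : C(stdSimplex ℝ (Fin (n + 1)), Y) → M) :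
    ∃ L : (singularChains A Y).X n →ₗ[A] M, ∀ f, L (simplexChain A f) = t f := by
  let Z := TopCat.toSSet.obj (TopCat.of Y)
  let c : Limits.Cofan (fun _ : Z _⦋n⦌ => ModuleCat.of A (ULift.{u} A)) :=
    Limits.Cofan.mk M fun τ => ModuleCat.ofHom
      ((LinearMap.toSpanSingleton A M (t (TopCat.toSSetObjEquiv (TopCat.of Y) (.op ⦋n⦌) τ))).comp
        (ULift.moduleEquiv (R := A) (M := A)).toLinearMap)
  let hc := Z.isColimitChainComplexXCofan (ModuleCat.of A (ULift.{u} A)) n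
  refine ⟨(hc.desc c).hom, fun f => ?_⟩
  have h := congrArg (fun g => g.hom (ULift.up 1)) <|
    hc.fac c ⟨(TopCat.toSSetObjEquiv (TopCat.of Y) (.op ⦋n⦌)).symm f⟩
  exact h.trans (by simp [c])

theorem span_simplexChain (n : ℕ) :
    Submodule.span A (range fun f : C(stdSimplex ℝ (Fin (n + 1)), Y) => simplexChain A f) = ⊤ := by
  set N := Submodule.span A (range fun f : C(stdSimplex ℝ (Fin (n + 1)), Y) => simplexChain A f)
  have mkQ_eq_zero : ModuleCat.ofHom N.mkQ = 0 := by
    refine SSet.chainComplex_hom_ext fun τ => ?_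
    obtain ⟨f, rfl⟩ := (TopCat.toSSetObjEquiv (TopCat.of Y) (.op ⦋n⦌)).symm.surjective τ
    refine ModuleCat.hom_ext (LinearMap.ext fun ⟨a⟩ => ?_)
    have ha : (ULift.up a : ULift.{u} A) = a • ULift.up 1 := by ext; simp
    rw [ha, map_smul, map_smul]
    congr 1
    simp only [Limits.comp_zero, ModuleCat.hom_zero, LinearMap.zero_apply]
    exact (Submodule.Quotient.mk_eq_zero N).2 (Submodule.subset_span ⟨f, rfl⟩)
  simpa using congrArg (fun g => LinearMap.ker g.hom) mkQ_eq_zero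

end SingularChains

section PathChains

variable (A : Type v) [CommRing A] {Y : Type u} [TopologicalSpace Y]

/-- The singular `1`-simplex of a path. -/
def pathSimplex {a b : Y} (p : Path a b) : C(stdSimplex ℝ (Fin 2), Y) :=
  p.toContinuousMap.comp ⟨stdSimplexHomeomorphUnitInterval,
    stdSimplexHomeomorphUnitInterval.continuous⟩

theorem pathSimplex_apply {a b : Y} (p : Path a b) (c : stdSimplex ℝ (Fin 2)) :
    pathSimplex p c = p (stdSimplexHomeomorphUnitInterval c) := rfl

theorem coe_stdSimplexHomeomorphUnitInterval (c : stdSimplex ℝ (Fin 2)) :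
    (stdSimplexHomeomorphUnitInterval c : ℝ) = c 1 := rfl

/-- The class of a path in the singular `1`-chains modulo boundaries. -/
def pathChain {a b : Y} (p : Path a b) : chainsModBoundaries A Y :=
  ((singularChains A Y).pOpcycles 1).hom (simplexChain A (pathSimplex p))

theorem pathChain_add_of_simplex {a b c : Y} (p : Path a b) (q : Path b c) (s : Path a c)
    (f : C(stdSimplex ℝ (Fin 3), Y)) (hp : face 2 f = pathSimplex p)
    (hq : face 0 f = pathSimplex q) (hs : face 1 f = pathSimplex s) :
    pathChain A p + pathChain A q = pathChain A s := by
  have boundary_eq_zero : ((singularChains A Y).pOpcycles 1).hom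
      (((singularChains A Y).d 2 1).hom (simplexChain A f)) = 0 :=
    congrArg (fun g => g.hom (simplexChain A f)) ((singularChains A Y).d_pOpcycles 2 1)
  have boundary_eq := d_simplexChain A f
  rw [Fin.sum_univ_three, hp, hq, hs] at boundary_eq
  rw [boundary_eq] at boundary_eq_zero
  simp only [Fin.val_zero, pow_zero, one_smul, Fin.val_one, pow_one, neg_smul, Fin.val_two,
    even_two, Even.neg_pow, one_pow, map_add, map_neg] at boundary_eq_zero
  rw [pathChain, pathChain, pathChain, ← sub_eq_zero, ← boundary_eq_zero]
  abel

theorem stdSimplex_map_succAbove_self {n : ℕ} (i : Fin (n + 1)) (c : stdSimplex ℝ (Fin n)) :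
    stdSimplex.map i.succAbove c i = 0 := by
  simp [stdSimplex.map_coe, FunOnFinite.linearMap_apply_apply, Fin.succAbove_ne]

theorem stdSimplex_map_succAbove_succAbove {n : ℕ} (i : Fin (n + 1)) (c : stdSimplex ℝ (Fin n))
    (k : Fin n) : stdSimplex.map i.succAbove c (i.succAbove k) = c k := by
  simp [stdSimplex.map_coe, FunOnFinite.linearMap_apply_apply, Finset.sum_filter]

/-- The affine map from the `2`-simplex to the triangle with vertices `(0, 0)`, `(1, 0)` and
`(1, 1)` in the unit square. -/
def triangleInSquare : C(stdSimplex ℝ (Fin 3), I × I) where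
  toFun b := (σ ⟨b 0, stdSimplex.zero_le b 0, stdSimplex.le_one b 0⟩,
    ⟨b 2, stdSimplex.zero_le b 2, stdSimplex.le_one b 2⟩)
  continuous_toFun := by
    have continuous_coord (i : Fin 3) : Continuous fun b : stdSimplex ℝ (Fin 3) => b i :=
      (continuous_apply i).comp continuous_subtype_val
    exact (continuous_symm.comp ((continuous_coord 0).subtype_mk _)).prodMk
      ((continuous_coord 2).subtype_mk _)

theorem triangleInSquare_faces (c : stdSimplex ℝ (Fin 2)) :
    face 2 triangleInSquare c = (stdSimplexHomeomorphUnitInterval c, 0) ∧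
      face 0 triangleInSquare c = (1, stdSimplexHomeomorphUnitInterval c) ∧
      face 1 triangleInSquare c =
        (stdSimplexHomeomorphUnitInterval c, stdSimplexHomeomorphUnitInterval c) := by
  have one_sub : 1 - c 0 = c 1 := by linarith [stdSimplex.add_eq_one c]
  have h00 := stdSimplex_map_succAbove_self (0 : Fin 3) c
  have h02 : stdSimplex.map (Fin.succAbove (0 : Fin 3)) c 2 = c 1 :=
    stdSimplex_map_succAbove_succAbove 0 c 1
  have h10 : stdSimplex.map (Fin.succAbove (1 : Fin 3)) c 0 = c 0 :=
    stdSimplex_map_succAbove_succAbove 1 c 0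
  have h12 : stdSimplex.map (Fin.succAbove (1 : Fin 3)) c 2 = c 1 :=
    stdSimplex_map_succAbove_succAbove 1 c 1
  have h20 : stdSimplex.map (Fin.succAbove (2 : Fin 3)) c 0 = c 0 :=
    stdSimplex_map_succAbove_succAbove 2 c 0
  have h22 := stdSimplex_map_succAbove_self (2 : Fin 3) c
  refine ⟨Prod.ext (Subtype.ext ?_) (Subtype.ext h22), Prod.ext (Subtype.ext ?_) (Subtype.ext h02),
    Prod.ext (Subtype.ext ?_) (Subtype.ext h12)⟩
  · exact (congrArg (1 - ·) h20).trans one_sub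
  · exact (congrArg (1 - ·) h00).trans (sub_zero 1)
  · exact (congrArg (1 - ·) h10).trans one_sub

theorem pathChain_add_of_square {a b c : Y} (F : C(I × I, Y)) (p : Path a b) (q : Path b c)
    (s : Path a c) (hp : ∀ t, F (t, 0) = p t) (hq : ∀ t, F (1, t) = q t)
    (hs : ∀ t, F (t, t) = s t) : pathChain A p + pathChain A q = pathChain A s := by
  refine pathChain_add_of_simplex A p q s (F.comp triangleInSquare) ?_ ?_ ?_ <;> ext c <;>
    obtain ⟨h2, h0, h1⟩ := triangleInSquare_faces c
  · exact (congrArg F h2).trans (hp _)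
  · exact (congrArg F h0).trans (hq _)
  · exact (congrArg F h1).trans (hs _)

theorem pathChain_refl (a : Y) : pathChain A (Path.refl a) = 0 :=
  left_eq_add.1 (pathChain_add_of_square A (.const _ a) (Path.refl a) (Path.refl a) (Path.refl a)
    (fun _ => rfl) (fun _ => rfl) fun _ => rfl).symm

theorem pathChain_trans {a b c : Y} (p : Path a b) (q : Path b c) :
    pathChain A (p.trans q) = pathChain A p + pathChain A q := by
  let F : C(I × I, Y) := ⟨fun x => (p.trans q).extend ((x.1 + x.2) / 2), by fun_prop⟩
  refine (pathChain_add_of_square A F p q (p.trans q) (fun t => ?_) (fun t => ?_)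
    fun t => ?_).symm
  · have ht : ((t : ℝ) + 0) / 2 ∈ I := ⟨by linarith [t.2.1], by linarith [t.2.2]⟩
    refine ((p.trans q).extend_apply ht).trans ?_
    rw [Path.trans_apply, dif_pos (show ((t : ℝ) + 0) / 2 ≤ 1 / 2 by linarith [t.2.2])]
    congr 1
    exact Subtype.ext (by simp; ring)
  · have ht : (1 + (t : ℝ)) / 2 ∈ I := ⟨by linarith [t.2.1], by linarith [t.2.2]⟩
    refine ((p.trans q).extend_apply ht).trans ?_
    rcases eq_or_ne t 0 with rfl | h
    · simp [Path.trans_apply]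
    have hpos : (0 : ℝ) < t := unitInterval.pos_iff_ne_zero.2 h
    rw [Path.trans_apply, dif_neg (show ¬(1 + (t : ℝ)) / 2 ≤ 1 / 2 by linarith)]
    congr 1
    exact Subtype.ext (by simp; ring)
  · simp [F]

theorem pathChain_congr {a b : Y} {p q : Path a b} (h : p.Homotopic q) :
    pathChain A p = pathChain A q := by
  obtain ⟨H⟩ := h
  let diagonal : Path a b := ⟨⟨fun t => H (t, t), by fun_prop⟩, by simp, by simp⟩
  have hp := pathChain_add_of_square A (H.toContinuousMap.comp .prodSwap) p (Path.refl b) diagonal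
    (fun t => by simp) (fun t => by simp) fun t => rfl
  have hq := pathChain_add_of_square A H.toContinuousMap (Path.refl a) q diagonal
    (fun t => by simp) (fun t => by simp) fun t => rfl
  rw [pathChain_refl, add_zero] at hp
  rw [pathChain_refl, zero_add] at hq
  exact hp.trans hq.symm

/-- The class modulo boundaries of a homotopy class of paths. -/
def classChain {a b : Y} (p : Homotopic.Quotient a b) : chainsModBoundaries A Y :=
  Quotient.lift (pathChain A) (fun _ _ h => pathChain_congr A h) p

theorem classChain_mk {a b : Y} (p : Path a b) :
    classChain A (Homotopic.Quotient.mk p) = pathChain A p := rfl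

theorem classChain_refl (a : Y) : classChain A (Homotopic.Quotient.refl a) = 0 :=
  pathChain_refl A a

theorem classChain_trans {a b c : Y} (p : Homotopic.Quotient a b) (q : Homotopic.Quotient b c) :
    classChain A (p.trans q) = classChain A p + classChain A q := by
  induction p with | mk p =>
  induction q with | mk q =>
  exact pathChain_trans A p q

theorem classChain_symm {a b : Y} (p : Homotopic.Quotient a b) :
    classChain A p.symm = -classChain A p := by
  rw [eq_neg_iff_add_eq_zero, ← classChain_trans, Homotopic.Quotient.symm_trans, classChain_refl]

theorem span_classChain :
    Submodule.span A {z | ∃ (a b : Y) (p : Homotopic.Quotient a b), classChain A p = z} = ⊤ := by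
  have hsurj : Function.Surjective ((singularChains A Y).pOpcycles 1).hom :=
    (ModuleCat.epi_iff_surjective _).1 inferInstance
  rw [eq_top_iff, ← LinearMap.range_eq_top.2 hsurj, LinearMap.range_eq_map,
    ← span_simplexChain A 1, Submodule.map_span]
  refine Submodule.span_mono ?_
  rintro _ ⟨_, ⟨f, rfl⟩, rfl⟩
  let p : Path (f (stdSimplexHomeomorphUnitInterval.symm 0))
      (f (stdSimplexHomeomorphUnitInterval.symm 1)) :=
    ⟨⟨fun t => f (stdSimplexHomeomorphUnitInterval.symm t), by fun_prop⟩, rfl, rfl⟩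
  refine ⟨_, _, Homotopic.Quotient.mk p, ?_⟩
  rw [classChain_mk, pathChain]
  congr 2
  ext c
  simp [pathSimplex_apply, p]

end PathChains

section Homology

variable (A : Type v) [CommRing A] {Y : Type u} [TopologicalSpace Y]

/-- The singular `0`-chain of a point. -/
def pointChain (y : Y) : (singularChains A Y).X 0 :=
  simplexChain A (n := 0) (ContinuousMap.const _ y)

theorem exists_linearMap_pointChain {M : ModuleCat.{max u v} A} (t : Y → M) :
    ∃ L : (singularChains A Y).X 0 →ₗ[A] M, ∀ y, L (pointChain A y) = t y := by
  obtain ⟨L, hL⟩ := exists_linearMap_simplexChain A (n := 0) (M := M)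
    (fun f : C(stdSimplex ℝ (Fin (0 + 1)), Y) => t (f default))
  exact ⟨L, fun y => hL _⟩

variable (Y) in
/-- The boundary map on the singular `1`-chains modulo boundaries. -/
def boundary : chainsModBoundaries A Y →ₗ[A] (singularChains A Y).X 0 :=
  ((singularChains A Y).fromOpcycles 1 0).hom

theorem face_zero_pathSimplex {a b : Y} (p : Path a b) :
    face 0 (pathSimplex p) = ContinuousMap.const _ b := by
  ext c
  have hc : stdSimplex.map (Fin.succAbove (0 : Fin 2)) c 1 = c 0 :=
    stdSimplex_map_succAbove_succAbove 0 c 0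
  have hend : stdSimplexHomeomorphUnitInterval (stdSimplex.map (Fin.succAbove 0) c) = 1 := by
    refine Subtype.ext ?_
    rw [coe_stdSimplexHomeomorphUnitInterval, hc]
    simp
  rw [face_apply, pathSimplex_apply, hend, p.target, ContinuousMap.const_apply]

theorem face_one_pathSimplex {a b : Y} (p : Path a b) :
    face 1 (pathSimplex p) = ContinuousMap.const _ a := by
  ext c
  have hstart : stdSimplexHomeomorphUnitInterval (stdSimplex.map (Fin.succAbove 1) c) = 0 :=
    Subtype.ext (stdSimplex_map_succAbove_self 1 c)
  rw [face_apply, pathSimplex_apply, hstart, p.source, ContinuousMap.const_apply]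

theorem boundary_classChain {a b : Y} (p : Homotopic.Quotient a b) :
    boundary A Y (classChain A p) = pointChain A b - pointChain A a := by
  induction p with | mk p =>
  have h := congrArg (fun g => g.hom (simplexChain A (pathSimplex p)))
    ((singularChains A Y).p_fromOpcycles 1 0)
  refine Eq.trans h ?_
  rw [d_simplexChain, Fin.sum_univ_two, face_zero_pathSimplex, face_one_pathSimplex]
  simp [pointChain, sub_eq_add_neg]

variable (Y) in
/-- The inclusion of the first homology into the singular `1`-chains modulo boundaries. -/
def homologyInclusion : H1 A Y →ₗ[A] chainsModBoundaries A Y :=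
  ((singularChains A Y).homologyι 1).hom

theorem homologyInclusion_injective : Function.Injective (homologyInclusion A Y) :=
  (ModuleCat.mono_iff_injective ((singularChains A Y).homologyι 1)).1 inferInstance

theorem range_homologyInclusion : LinearMap.range (homologyInclusion A Y) =
    LinearMap.ker (boundary A Y) :=
  (ShortComplex.Exact.moduleCat_range_eq_ker (ShortComplex.exact_of_f_is_kernel
    (ShortComplex.mk _ _ ((singularChains A Y).homologyι_comp_fromOpcycles 1 0))
      ((singularChains A Y).homologyIsKernel 1 0 (by simp))))

variable {X : Type u} [TopologicalSpace X] (φ : C(X, Y))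

/-- The map on singular chains induced by a continuous map. -/
abbrev singularChainsMap : singularChains A X ⟶ singularChains A Y :=
  SSet.chainComplexMap (TopCat.toSSet.map (TopCat.ofHom φ)) (ModuleCat.of A (ULift.{u} A))

/-- The map on first homology induced by a continuous map. -/
def homologyMap : H1 A X →ₗ[A] H1 A Y :=
  (HomologicalComplex.homologyMap (singularChainsMap A φ) 1).hom

/-- The map on `1`-chains modulo boundaries induced by a continuous map. -/
def chainsModBoundariesMap : chainsModBoundaries A X →ₗ[A] chainsModBoundaries A Y :=
  (HomologicalComplex.opcyclesMap (singularChainsMap A φ) 1).hom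

theorem homologyInclusion_homologyMap (z : H1 A X) :
    homologyInclusion A Y (homologyMap A φ z) =
      chainsModBoundariesMap A φ (homologyInclusion A X z) :=
  congrArg (fun g => g.hom z) (HomologicalComplex.homologyι_naturality (singularChainsMap A φ) 1)

theorem chainsModBoundariesMap_classChain {a b : X} (p : Homotopic.Quotient a b) :
    chainsModBoundariesMap A φ (classChain A p) = classChain A (p.map φ) := by
  induction p with | mk p =>
  rw [← Homotopic.Quotient.mk_map, classChain_mk, classChain_mk]
  refine (congrArg (fun g => g.hom (simplexChain A (pathSimplex p)))
    (HomologicalComplex.p_opcyclesMap (singularChainsMap A φ) 1)).trans ?_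
  exact congrArg ((singularChains A Y).pOpcycles 1).hom <|
    congrArg (fun g => g.hom (ULift.up 1)) <| SSet.ι_chainComplexMap_f _ _
      (f := TopCat.toSSet.map (TopCat.ofHom φ)) (R := ModuleCat.of A (ULift.{u} A)) (n := 1)
      ((TopCat.toSSetObjEquiv (TopCat.of X) (.op ⦋1⦌)).symm (pathSimplex p))

end Homology

section Mgs

theorem mgs_le {G : Type*} [Group G] {S : Set G} (hS : Subgroup.closure S = ⊤) :
    mgs G ≤ S.encard :=
  iInf₂_le S hS

theorem exists_encard_eq_mgs (G : Type*) [Group G] :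
    ∃ S : Set G, Subgroup.closure S = ⊤ ∧ S.encard = mgs G := by
  have : Nonempty {S : Set G // Subgroup.closure S = ⊤} := ⟨⟨univ, Subgroup.closure_univ⟩⟩
  obtain ⟨S, hS⟩ := ciInf_mem fun S : {S : Set G // Subgroup.closure S = ⊤} => (S : Set G).encard
  exact ⟨S.1, S.2, hS.trans (by rw [mgs, iInf_subtype'])⟩

theorem mgs_le_of_surjective {G H : Type*} [Group G] [Group H] (f : G →* H)
    (hf : Function.Surjective f) : mgs H ≤ mgs G := by
  obtain ⟨S, hS, hcard⟩ := exists_encard_eq_mgs G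
  have closure_image : Subgroup.closure (f '' S) = ⊤ := by
    rw [← MonoidHom.map_closure, hS, ← MonoidHom.range_eq_map, MonoidHom.range_eq_top.2 hf]
  exact (mgs_le closure_image).trans ((encard_image_le _ _).trans hcard.le)

theorem mgsModule_le {A : Type*} [CommRing A] {M : Type*} [AddCommGroup M] [Module A M]
    {S : Set M} (hS : Submodule.span A S = ⊤) : mgsModule A M ≤ S.encard :=
  iInf₂_le S hS

theorem exists_encard_eq_mgsModule (A : Type*) [CommRing A] (M : Type*) [AddCommGroup M]
    [Module A M] : ∃ S : Set M, Submodule.span A S = ⊤ ∧ S.encard = mgsModule A M := by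
  have : Nonempty {S : Set M // Submodule.span A S = ⊤} := ⟨⟨univ, Submodule.span_univ⟩⟩
  obtain ⟨S, hS⟩ := ciInf_mem fun S : {S : Set M // Submodule.span A S = ⊤} => (S : Set M).encard
  exact ⟨S.1, S.2, hS.trans (by rw [mgsModule, iInf_subtype'])⟩

theorem mgs_fundamentalGroup_le_of_joined {Y : Type*} [TopologicalSpace Y] {a b : Y}
    (h : Joined a b) : mgs (FundamentalGroup Y a) ≤ mgs (FundamentalGroup Y b) :=
  let e := FundamentalGroup.fundamentalGroupMulEquivOfPath h.symm.somePath
  mgs_le_of_surjective e.toMonoidHom e.surjective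

variable {Y : Type u} [TopologicalSpace Y]

theorem joined_out_iff {j : ZerothHomotopy Y} {y : Y} :
    Joined (Quotient.out j) y ↔ ZerothHomotopy.mk y = j := by
  constructor
  · exact fun h => (Quotient.sound h.symm).trans (Quotient.out_eq j)
  · rintro rfl
    exact Quotient.exact (Quotient.out_eq (ZerothHomotopy.mk y))

theorem zerothHomotopy_mk_eq {a b : Y} (p : Homotopic.Quotient a b) :
    ZerothHomotopy.mk a = ZerothHomotopy.mk b :=
  Quotient.sound (joined_of_pathClass p)

theorem mgs_le_MGS [Finite (ZerothHomotopy Y)] (y : Y) : mgs (FundamentalGroup Y y) ≤ MGS Y := by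
  have := Fintype.ofFinite (ZerothHomotopy Y)
  rw [MGS, tsum_fintype]
  exact (mgs_fundamentalGroup_le_of_joined (joined_out_iff.2 rfl).symm).trans
    (Finset.single_le_sum
      (f := fun j : ZerothHomotopy Y => mgs (FundamentalGroup Y (Quotient.out j)))
      (fun _ _ => zero_le) (Finset.mem_univ (ZerothHomotopy.mk y)))

end Mgs

section PathGeneratedBy

variable {X Y : Type u} [TopologicalSpace X] [TopologicalSpace Y] {K : Type*}

/-- `Y` is generated by `X`, mapped to `Y` by `φ`, and a family `e` of path classes: every point of
`Y` can be joined to the image of `φ`, and every path class in `Y` between points of this image is a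
composite of images of path classes in `X` and of classes `e k` and their inverses. -/
structure PathGeneratedBy (φ : C(X, Y)) {s t : K → X}
    (e : ∀ k, Homotopic.Quotient (φ (s k)) (φ (t k))) : Prop where
  exists_joined (y : Y) : ∃ x, Joined (φ x) y
  eq_top (S : CategoryTheory.Subgroupoid (FundamentalGroupoidOn φ))
    (map_mem : ∀ (x x' : X) (p : Homotopic.Quotient x x'), p.map φ ∈ S.arrows x x')
    (mem : ∀ k, e k ∈ S.arrows (s k) (t k)) : S = ⊤

/-- A path class to `y` from the chosen point of its path component. -/
def fromOut (y : Y) : Homotopic.Quotient (Quotient.out (ZerothHomotopy.mk y)) y :=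
  Homotopic.Quotient.mk (joined_out_iff.2 rfl).somePath

end PathGeneratedBy

section HomologyBound

variable (A : Type v) [CommRing A] {X Y : Type u} [TopologicalSpace X] [TopologicalSpace Y]

theorem exists_homologyInclusion_eq {z : chainsModBoundaries A Y} (hz : boundary A Y z = 0) :
    ∃ c, homologyInclusion A Y c = z := by
  rwa [← LinearMap.mem_range, range_homologyInclusion, LinearMap.mem_ker]

/-- The path classes which lie in a submodule `T` of the chains modulo boundaries after their end
points have been corrected by `t`. -/
def correctedChainSubgroupoid {J : Type*} (w : J → Y) (t : J → chainsModBoundaries A Y)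
    (T : Submodule A (chainsModBoundaries A Y)) :
    CategoryTheory.Subgroupoid (FundamentalGroupoidOn w) where
  arrows i j := {p | t i + classChain A p - t j ∈ T}
  inv {i j p} hp := by
    change t j + classChain A (Homotopic.Quotient.symm p) - t i ∈ T
    rw [classChain_symm]
    convert T.neg_mem hp using 1
    abel
  mul {i j k p} hp {q} hq := by
    change t i + classChain A (Homotopic.Quotient.trans p q) - t k ∈ T
    rw [classChain_trans]
    convert T.add_mem hp hq using 1
    abel

theorem ker_boundary_le (t : Y → chainsModBoundaries A Y)
    (T : Submodule A (chainsModBoundaries A Y))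
    (hT : ∀ (a b : Y) (p : Homotopic.Quotient a b), t a + classChain A p - t b ∈ T) :
    LinearMap.ker (boundary A Y) ≤ T := by
  obtain ⟨L, hL⟩ := exists_linearMap_pointChain A t
  have corrected_mem : ⊤ ≤ T.comap (LinearMap.id - L ∘ₗ boundary A Y) := by
    rw [← span_classChain A, Submodule.span_le]
    rintro _ ⟨a, b, p, rfl⟩
    rw [SetLike.mem_coe, Submodule.mem_comap]
    convert hT a b p using 1
    simp only [LinearMap.sub_apply, LinearMap.id_apply, LinearMap.comp_apply, boundary_classChain,
      map_sub, hL]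
    abel
  intro z hz
  have h := corrected_mem (Submodule.mem_top (x := z))
  simpa [LinearMap.mem_ker.1 hz] using h

theorem ker_boundary_le_of_joined {J : Type*} (w : J → Y) (hw : ∀ y, ∃ j, Joined (w j) y)
    (t : J → chainsModBoundaries A Y) (T : Submodule A (chainsModBoundaries A Y))
    (hT : correctedChainSubgroupoid A w t T = ⊤) : LinearMap.ker (boundary A Y) ≤ T := by
  choose ν hν using hw
  let ℓ (y : Y) : Homotopic.Quotient (w (ν y)) y := Homotopic.Quotient.mk (hν y).somePath
  refine ker_boundary_le A (fun y => t (ν y) + classChain A (ℓ y)) T fun a b p => ?_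
  have h : ((ℓ a).trans p).trans (ℓ b).symm ∈
      (correctedChainSubgroupoid A w t T).arrows (ν a) (ν b) :=
    hT ▸ CategoryTheory.Subgroupoid.mem_top _
  change t (ν a) + classChain A _ - t (ν b) ∈ T at h
  convert h using 1
  rw [classChain_trans, classChain_trans, classChain_symm]
  abel

theorem exists_homologyInclusion_eq_fromOut {j j' : ZerothHomotopy Y} {a b : Y}
    (p : Homotopic.Quotient (Quotient.out j) a) (q : Homotopic.Quotient (Quotient.out j') b)
    (g : Homotopic.Quotient a b) :
    ∃ c, homologyInclusion A Y c = classChain A p + classChain A g - classChain A q := by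
  have hab : j = j' := (joined_out_iff.1 (joined_of_pathClass p)).symm.trans
    ((zerothHomotopy_mk_eq g).trans
      (joined_out_iff.1 (joined_of_pathClass q)))
  refine exists_homologyInclusion_eq A ?_
  rw [map_sub, map_add, boundary_classChain, boundary_classChain, boundary_classChain, hab]
  abel

theorem PathGeneratedBy.mgsModule_H1_le {φ : C(X, Y)} {K : Type*} {s t : K → X}
    {e : ∀ k, Homotopic.Quotient (φ (s k)) (φ (t k))} (he : PathGeneratedBy φ e) :
    mgsModule A (H1 A Y) ≤ mgsModule A (H1 A X) + ENat.card K := by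
  obtain ⟨S, hS, hcard⟩ := exists_encard_eq_mgsModule A (H1 A X)
  let compPath (i : ZerothHomotopy X) := fromOut (φ (Quotient.out i))
  let basePath (x : X) := (compPath (ZerothHomotopy.mk x)).trans ((fromOut x).map φ)
  let corr (x : X) := classChain A (basePath x)
  choose z hz using fun k =>
    exists_homologyInclusion_eq_fromOut A (basePath (s k)) (basePath (t k)) (e k)
  let W : Set (H1 A Y) := homologyMap A φ '' S ∪ range z
  let G := correctedChainSubgroupoid A φ corr ((Submodule.span A W).map (homologyInclusion A Y))
  have map_mem (x x' : X) (p : Homotopic.Quotient x x') : p.map φ ∈ G.arrows x x' := by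
    obtain ⟨c, hc⟩ := exists_homologyInclusion_eq_fromOut A (fromOut x) (fromOut x') p
    have c_mem : homologyMap A φ c ∈ Submodule.span A W := by
      refine Submodule.span_mono subset_union_left ?_
      rw [← Submodule.map_span, hS]
      exact Submodule.mem_map_of_mem Submodule.mem_top
    refine ⟨homologyMap A φ c, c_mem, ?_⟩
    rw [homologyInclusion_homologyMap, hc, map_sub, map_add]
    have compPath_eq := congrArg (fun i => classChain A (compPath i)) (zerothHomotopy_mk_eq p)
    simp only [chainsModBoundariesMap_classChain, corr, basePath, classChain_trans, compPath_eq]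
    abel
  have mem (k : K) : e k ∈ G.arrows (s k) (t k) :=
    ⟨z k, Submodule.subset_span (Or.inr ⟨k, rfl⟩), hz k⟩
  have ker_le := ker_boundary_le_of_joined A φ he.exists_joined corr _ (he.eq_top _ map_mem mem)
  rw [← range_homologyInclusion, LinearMap.range_eq_map,
    Submodule.map_le_map_iff_of_injective (homologyInclusion_injective A)] at ker_le
  refine (mgsModule_le (top_unique ker_le)).trans ((encard_union_le _ _).trans (add_le_add ?_ ?_))
  · exact (encard_image_le _ _).trans hcard.le
  · rw [← image_univ, ← encard_univ]
    exact encard_image_le _ _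

end HomologyBound

section FundamentalGroupBound

variable {X Y : Type u} [TopologicalSpace X] [TopologicalSpace Y]

/-- The loop obtained from a path class by joining its end points to a base point. -/
def loopOf {ρ a b : Y} (s : Homotopic.Quotient ρ a) (p : Homotopic.Quotient a b)
    (t : Homotopic.Quotient ρ b) : FundamentalGroup Y ρ :=
  FundamentalGroup.fromPath ((s.trans p).trans t.symm)

theorem loopOf_trans {ρ a b c : Y} (s : Homotopic.Quotient ρ a) (p : Homotopic.Quotient a b)
    (t : Homotopic.Quotient ρ b) (q : Homotopic.Quotient b c) (x : Homotopic.Quotient ρ c) :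
    loopOf s (p.trans q) x = loopOf t q x * loopOf s p t := by
  rw [FundamentalGroup.mul_def]
  change _ = Homotopic.Quotient.trans ((s.trans p).trans t.symm) ((t.trans q).trans x.symm)
  simp only [loopOf, Homotopic.Quotient.trans_assoc, symm_trans_trans]

theorem loopOf_refl {ρ a : Y} (s : Homotopic.Quotient ρ a) :
    loopOf s (Homotopic.Quotient.refl a) s = 1 := by
  rw [loopOf, Homotopic.Quotient.trans_refl, Homotopic.Quotient.trans_symm]
  rfl

theorem loopOf_symm {ρ a b : Y} (s : Homotopic.Quotient ρ a) (p : Homotopic.Quotient a b)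
    (t : Homotopic.Quotient ρ b) : loopOf t p.symm s = (loopOf s p t)⁻¹ := by
  rw [eq_inv_iff_mul_eq_one, ← loopOf_trans, Homotopic.Quotient.trans_symm, loopOf_refl]

theorem loopOf_symm_trans_trans {ρ a : Y} (s : Homotopic.Quotient ρ a)
    (g : FundamentalGroup Y ρ) :
    loopOf s ((s.symm.trans (FundamentalGroup.toPath g)).trans s) s = g := by
  simp [loopOf, Homotopic.Quotient.trans_assoc]

/-- The path classes which become elements of a subgroup `H` of the fundamental group when their end
points are joined to the base point by the paths `τ`. -/
def loopSubgroupoid {J : Type*} (w : J → Y) {ρ : Y}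
    (τ : ∀ j, Joined ρ (w j) → Homotopic.Quotient ρ (w j)) (H : Subgroup (FundamentalGroup Y ρ)) :
    CategoryTheory.Subgroupoid (FundamentalGroupoidOn w) where
  arrows i j := {p | ∀ hi hj, loopOf (τ i hi) p (τ j hj) ∈ H}
  inv {i j p} hp hj hi := by
    change loopOf (τ j hj) (Homotopic.Quotient.symm p) (τ i hi) ∈ H
    rw [loopOf_symm]
    exact H.inv_mem (hp hi hj)
  mul {i j k p} hp {q} hq hi hk := by
    have hj := hi.trans (joined_of_pathClass p)
    change loopOf (τ i hi) (Homotopic.Quotient.trans p q) (τ k hk) ∈ H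
    rw [loopOf_trans _ p (τ j hj)]
    exact H.mul_mem (hq hj hk) (hp hi hj)

theorem eq_top_of_loopSubgroupoid_eq_top {J : Type*} {w : J → Y} {ρ : Y}
    {τ : ∀ j, Joined ρ (w j) → Homotopic.Quotient ρ (w j)} {H : Subgroup (FundamentalGroup Y ρ)}
    (h : loopSubgroupoid w τ H = ⊤) {j : J} (hj : Joined ρ (w j)) : H = ⊤ := by
  refine top_unique fun g _ => ?_
  have loop_mem : ((τ j hj).symm.trans (FundamentalGroup.toPath g)).trans (τ j hj) ∈
      (loopSubgroupoid w τ H).arrows j j := h ▸ CategoryTheory.Subgroupoid.mem_top _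
  rw [← loopOf_symm_trans_trans (τ j hj) g]
  exact loop_mem hj hj

/-- The homomorphism of fundamental groups induced by a continuous map and a change of base
point. -/
def pushHom (φ : C(X, Y)) {x : X} {ρ : Y} (c : Homotopic.Quotient ρ (φ x)) :
    FundamentalGroup X x →* FundamentalGroup Y ρ where
  toFun g := loopOf c ((FundamentalGroup.toPath g).map φ) c
  map_one' := loopOf_refl c
  map_mul' g h := by
    rw [← loopOf_trans]
    exact congrArg (loopOf c · c) (map_trans_class φ _ _)

theorem loopOf_map (φ : C(X, Y)) {b x x' : X} {ρ : Y} (c : Homotopic.Quotient ρ (φ b))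
    (s : Homotopic.Quotient b x) (p : Homotopic.Quotient x x') (s' : Homotopic.Quotient b x') :
    loopOf (c.trans (s.map φ)) (p.map φ) (c.trans (s'.map φ)) = pushHom φ c (loopOf s p s') := by
  simp only [pushHom, loopOf, MonoidHom.coe_mk, OneHom.coe_mk, map_trans_class, map_symm_class,
    symm_trans_class, Homotopic.Quotient.trans_assoc]

variable {φ : C(X, Y)} {K : Type*} {s t : K → X}
  {e : ∀ k, Homotopic.Quotient (φ (s k)) (φ (t k))}

theorem PathGeneratedBy.exists_closure_eq_top (he : PathGeneratedBy φ e) {ρ : Y}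
    (c : ∀ i : ZerothHomotopy X, Joined ρ (φ (Quotient.out i)) →
      Homotopic.Quotient ρ (φ (Quotient.out i)))
    (S : ∀ i : ZerothHomotopy X, Set (FundamentalGroup X (Quotient.out i)))
    (hS : ∀ i, Subgroup.closure (S i) = ⊤) :
    ∃ g : {k // Joined ρ (φ (s k))} → FundamentalGroup Y ρ,
      Subgroup.closure ((⋃ i : {i : ZerothHomotopy X // Joined ρ (φ (Quotient.out i))},
        pushHom φ (c i i.2) '' S i) ∪ range g) = ⊤ := by
  have joined_out {x : X} (hx : Joined ρ (φ x)) :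
      Joined ρ (φ (Quotient.out (ZerothHomotopy.mk x))) :=
    hx.trans (((joined_out_iff.2 rfl).map φ.continuous).symm)
  let τ (x : X) (hx : Joined ρ (φ x)) : Homotopic.Quotient ρ (φ x) :=
    (c _ (joined_out hx)).trans ((fromOut x).map φ)
  have τ_eq (x : X) (hx) (i) (hi : ZerothHomotopy.mk x = i) :
      ∃ hi, ∃ p : Homotopic.Quotient (Quotient.out i) x, τ x hx = (c i hi).trans (p.map φ) := by
    subst hi
    exact ⟨joined_out hx, fromOut x, rfl⟩
  let g (k : {k // Joined ρ (φ (s k))}) : FundamentalGroup Y ρ :=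
    loopOf (τ _ k.2) (e k) (τ _ (k.2.trans (joined_of_pathClass (e k))))
  refine ⟨g, ?_⟩
  set W := (⋃ i : {i : ZerothHomotopy X // Joined ρ (φ (Quotient.out i))},
    pushHom φ (c i i.2) '' S i) ∪ range g
  have push_mem (i : ZerothHomotopy X) (hi) (h) :
      pushHom φ (c i hi) h ∈ Subgroup.closure W := by
    have h_mem := Subgroup.mem_map_of_mem (pushHom φ (c i hi)) (hS i ▸ Subgroup.mem_top h)
    rw [MonoidHom.map_closure] at h_mem
    exact Subgroup.closure_mono (fun z hz => Or.inl (mem_iUnion.2 ⟨⟨i, hi⟩, hz⟩)) h_mem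
  have map_mem (x x' : X) (p : Homotopic.Quotient x x') :
      p.map φ ∈ (loopSubgroupoid φ τ (Subgroup.closure W)).arrows x x' := by
    intro hx hx'
    obtain ⟨hi, q, hq⟩ := τ_eq x hx _ rfl
    obtain ⟨_, q', hq'⟩ := τ_eq x' hx' _ (zerothHomotopy_mk_eq p).symm
    rw [hq, hq', loopOf_map]
    exact push_mem _ hi _
  have mem (k : K) : e k ∈ (loopSubgroupoid φ τ (Subgroup.closure W)).arrows (s k) (t k) :=
    fun hs _ => Subgroup.subset_closure (Or.inr ⟨⟨k, hs⟩, rfl⟩)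
  obtain ⟨x, hx⟩ := he.exists_joined ρ
  exact eq_top_of_loopSubgroupoid_eq_top (he.eq_top _ map_mem mem) hx.symm

open scoped Classical in
theorem PathGeneratedBy.mgs_fundamentalGroup_le [Fintype (ZerothHomotopy X)]
    (he : PathGeneratedBy φ e) (j : ZerothHomotopy Y) :
    mgs (FundamentalGroup Y (Quotient.out j)) ≤
      ∑ i : ZerothHomotopy X with ZerothHomotopy.mk (φ (Quotient.out i)) = j,
        mgs (FundamentalGroup X (Quotient.out i)) +
      {k | ZerothHomotopy.mk (φ (s k)) = j}.encard := by
  choose S hS hcard using fun i : ZerothHomotopy X =>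
    exists_encard_eq_mgs (FundamentalGroup X (Quotient.out i))
  obtain ⟨g, hg⟩ := he.exists_closure_eq_top (fun _ hi => Homotopic.Quotient.mk hi.somePath) S hS
  refine (mgs_le hg).trans ((encard_union_le _ _).trans (add_le_add ?_ ?_))
  · refine (encard_iUnion_le_of_fintype _).trans ((Finset.sum_le_sum fun i _ => ?_).trans
      (Finset.sum_subtype _ (fun i => ?_) _).ge)
    · exact (encard_image_le _ _).trans (hcard i).le
    · exact (Finset.mem_filter_univ i).trans joined_out_iff.symm
  · rw [← image_univ]
    refine (encard_image_le _ _).trans ((encard_univ _).trans_le ?_)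
    exact (ENat.card_congr (Equiv.subtypeEquivRight fun _ => joined_out_iff)).le

theorem PathGeneratedBy.finite_zerothHomotopy [Finite (ZerothHomotopy X)]
    (he : PathGeneratedBy φ e) : Finite (ZerothHomotopy Y) := by
  refine Finite.of_surjective
    (fun i : ZerothHomotopy X => ZerothHomotopy.mk (φ (Quotient.out i))) fun j => ?_
  obtain ⟨y, rfl⟩ := ZerothHomotopy.mk_surjective j
  obtain ⟨x, hx⟩ := he.exists_joined y
  exact ⟨ZerothHomotopy.mk x,
    Quotient.sound (((joined_out_iff.2 rfl).map φ.continuous).trans hx)⟩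

theorem PathGeneratedBy.MGS_le [Finite (ZerothHomotopy X)]
    (he : PathGeneratedBy φ e) : MGS Y ≤ MGS X + ENat.card K := by
  classical
  have := he.finite_zerothHomotopy
  have := Fintype.ofFinite (ZerothHomotopy X)
  have := Fintype.ofFinite (ZerothHomotopy Y)
  rw [MGS, MGS, tsum_fintype, tsum_fintype]
  refine (Finset.sum_le_sum fun j _ => he.mgs_fundamentalGroup_le j).trans ?_
  rw [Finset.sum_add_distrib]
  refine add_le_add (Finset.sum_fiberwise (Finset.univ : Finset (ZerothHomotopy X)) _ _).le ?_
  rw [← finsum_eq_sum_of_fintype, ← encard_iUnion_of_finite, ← encard_univ]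
  · exact encard_le_encard (subset_univ _)
  · exact fun j j' hj => Set.disjoint_left.2 fun k hk hk' => hj (hk.symm.trans hk')

end FundamentalGroupBound

section RealizationTopology

variable {ι : Type u} {K : PreAbstractSimplicialComplex ι}

theorem extendCoord_apply (s : Finset ι) (g : s → ℝ) {i : ι} (hi : i ∈ s) :
    extendCoord s g i = g ⟨i, hi⟩ :=
  Finsupp.embDomain_apply_self (Function.Embedding.subtype (· ∈ s)) _ ⟨i, hi⟩

theorem extendCoord_apply_of_notMem (s : Finset ι) (g : s → ℝ) {i : ι} (hi : i ∉ s) :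
    extendCoord s g i = 0 :=
  Finsupp.notMem_support_iff.1 fun h => hi (extendCoord_support_subset s g h)

theorem continuous_extendCoord (s : Finset ι) (i : ι) :
    Continuous fun g : s → ℝ => extendCoord s g i := by
  by_cases hi : i ∈ s
  · simp_rw [extendCoord_apply s _ hi]
    fun_prop
  · simp_rw [extendCoord_apply_of_notMem s _ hi]
    fun_prop

theorem continuous_simplexMap (s : K.faces) : Continuous (simplexMap K s) :=
  continuous_iff_coinduced_le.2 (le_iSup (fun s : K.faces =>
    TopologicalSpace.coinduced (simplexMap K s) inferInstance) s)

theorem continuous_coord (i : ι) : Continuous fun p : Realization K => p.1 i :=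
  continuous_iSup_dom.2 fun s => continuous_coinduced_dom.2
    ((continuous_extendCoord (s : Finset ι) i).comp continuous_subtype_val)

namespace Realization

theorem ext_apply {p q : Realization K} (h : ∀ i, p.1 i = q.1 i) : p = q :=
  Subtype.ext (Finsupp.ext h)

theorem sum_eq_one (p : Realization K) {s : Finset ι} (hs : p.1.support ⊆ s) :
    ∑ i ∈ s, p.1 i = 1 :=
  (Finsupp.sum_of_support_subset _ hs _ fun _ _ => rfl).symm.trans p.2.2.2

/-- The barycentric coordinates of `p` in a closed simplex `s` which contains `p`. -/
def coords (p : Realization K) {s : Finset ι} (hs : p.1.support ⊆ s) : stdSimplex ℝ s :=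
  ⟨fun i => p.1 i, fun i => p.2.2.1 i, (s.sum_coe_sort p.1).trans (p.sum_eq_one hs)⟩

theorem simplexMap_coords (p : Realization K) (s : K.faces) (hs : p.1.support ⊆ s) :
    simplexMap K s (p.coords hs) = p := by
  refine ext_apply fun i => ?_
  by_cases hi : i ∈ (s : Finset ι)
  · exact extendCoord_apply _ _ hi
  · exact (extendCoord_apply_of_notMem _ _ hi).trans
      (Finsupp.notMem_support_iff.1 fun h => hi (hs h)).symm

theorem isQuotientMap_simplexMap :
    IsQuotientMap fun z : Σ s : K.faces, stdSimplex ℝ (s : Finset ι) => simplexMap K z.1 z.2 := by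
  refine ⟨⟨?_⟩, fun p => ⟨⟨⟨_, p.2.1⟩, p.coords subset_rfl⟩, p.simplexMap_coords _ subset_rfl⟩⟩
  change _ = TopologicalSpace.coinduced _ (⨆ s, _)
  rw [coinduced_iSup]
  rfl

theorem isClosed_support_subset {Z : Type*} [TopologicalSpace Z] {F : Z → Realization K}
    (hF : ∀ i, Continuous fun z => (F z).1 i) (s : Finset ι) :
    IsClosed {z | (F z).1.support ⊆ s} := by
  have : {z | (F z).1.support ⊆ s} = ⋂ i ∈ {i | i ∉ s}, {z | (F z).1 i = 0} := by
    ext z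
    simp only [Finset.subset_iff, mem_ofPred_eq, mem_iInter, ← Finsupp.notMem_support_iff]
    exact forall_congr' fun i => not_imp_not.symm
  rw [this]
  exact isClosed_biInter fun i _ => isClosed_eq (hF i) continuous_const

theorem continuous_of_coord {Z : Type*} [TopologicalSpace Z] {F : Z → Realization K}
    {T : Finset ι} (hT : ∀ z, (F z).1.support ⊆ T) (hF : ∀ i, Continuous fun z => (F z).1 i) :
    Continuous F := by
  have : Finite {s : K.faces // (s : Finset ι) ⊆ T} :=
    Finite.of_injective (fun s => (⟨s.1.1, Finset.mem_powerset.2 s.2⟩ : T.powerset))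
      fun s t h => Subtype.ext (Subtype.ext (Subtype.mk.inj h))
  have hcover : ⋃ s : {s : K.faces // (s : Finset ι) ⊆ T}, {z | (F z).1.support ⊆ s.1.1} = univ :=
    eq_univ_of_forall fun z => mem_iUnion.2 ⟨⟨⟨_, (F z).2.1⟩, hT z⟩, Finset.Subset.refl _⟩
  refine (locallyFinite_of_finite _).continuous hcover
    (fun s => isClosed_support_subset hF s.1.1) fun s => ?_
  rw [continuousOn_iff_continuous_domRestrict]
  have factor : {z | (F z).1.support ⊆ s.1.1}.domRestrict F =
      fun z : {z | (F z).1.support ⊆ s.1.1} => simplexMap K s.1 ((F z).coords z.2) :=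
    funext fun z => ((F z).simplexMap_coords s.1 z.2).symm
  rw [factor]
  refine (continuous_simplexMap s.1).comp (Continuous.subtype_mk (continuous_pi fun i => ?_) _)
  exact (hF _).comp continuous_subtype_val

/-- Two points of the realization are contiguous if they lie in a common closed simplex. -/
def Contiguous (p q : Realization K) : Prop :=
  ∃ s ∈ K.faces, p.1.support ⊆ s ∧ q.1.support ⊆ s

theorem Contiguous.symm {p q : Realization K} (h : p.Contiguous q) : q.Contiguous p :=
  let ⟨s, hs, hp, hq⟩ := h
  ⟨s, hs, hq, hp⟩

theorem Contiguous.rfl {p : Realization K} : p.Contiguous p :=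
  ⟨_, p.2.1, subset_rfl, subset_rfl⟩

theorem support_combo_subset {f g : ι →₀ ℝ} {T : Finset ι} (hf : f.support ⊆ T)
    (hg : g.support ⊆ T) (t : ℝ) : ((1 - t) • f + t • g).support ⊆ T := by
  classical
  exact Finsupp.support_add.trans
    (Finset.union_subset (Finsupp.support_smul.trans hf) (Finsupp.support_smul.trans hg))

/-- The convex combination `(1 - t) p + t q` of two contiguous points. -/
def combo (p q : Realization K) (h : p.Contiguous q) (t : I) : Realization K :=
  ⟨(1 - t : ℝ) • p.1 + (t : ℝ) • q.1, by
    obtain ⟨s, hs, hp, hq⟩ := h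
    have hsub := support_combo_subset hp hq (t : ℝ)
    have hsum : (((1 - t : ℝ) • p.1 + (t : ℝ) • q.1).sum fun _ a => a) = 1 := by
      rw [Finsupp.sum_of_support_subset _ hsub _ fun _ _ => rfl]
      simp only [Finsupp.add_apply, Finsupp.smul_apply, smul_eq_mul, Finset.sum_add_distrib,
        ← Finset.mul_sum, p.sum_eq_one hp, q.sum_eq_one hq]
      ring
    refine ⟨(K.isRelLowerSet_faces hs).2 hsub ?_, fun i => ?_, hsum⟩
    · by_contra hempty
      rw [Finset.not_nonempty_iff_eq_empty] at hempty
      simp [Finsupp.sum, hempty] at hsum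
    · exact add_nonneg (mul_nonneg (sub_nonneg.2 t.2.2) (p.2.2.1 i))
        (mul_nonneg t.2.1 (q.2.2.1 i))⟩

theorem combo_apply (p q : Realization K) (h) (t : I) (i : ι) :
    (p.combo q h t).1 i = (1 - t : ℝ) * p.1 i + t * q.1 i :=
  rfl

/-- The straight path between two contiguous points. -/
def line (p q : Realization K) (h : p.Contiguous q) : Path p q where
  toFun := p.combo q h
  continuous_toFun := by
    obtain ⟨s, _, hp, hq⟩ := id h
    refine continuous_of_coord (fun t => support_combo_subset hp hq (t : ℝ)) fun i => ?_
    simp_rw [combo_apply]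
    fun_prop
  source' := ext_apply fun i => by simp [combo_apply]
  target' := ext_apply fun i => by simp [combo_apply]

theorem line_apply (p q : Realization K) (h) (t : I) : p.line q h t = p.combo q h t :=
  rfl

theorem line_square {a b c d : Realization K} (p : Path a b) (q : Path c d) {T : Finset ι}
    (hp : ∀ t, (p t).1.support ⊆ T) (hq : ∀ t, (q t).1.support ⊆ T)
    (h : ∀ t, (p t).Contiguous (q t)) (hac : a.Contiguous c) (hbd : b.Contiguous d) :
    (Homotopic.Quotient.mk p).trans (Homotopic.Quotient.mk (b.line d hbd)) =
      (Homotopic.Quotient.mk (a.line c hac)).trans (Homotopic.Quotient.mk q) := by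
  let F (z : I × I) : Realization K := (p z.1).combo (q z.1) (h z.1) z.2
  have hF : Continuous F := by
    refine continuous_of_coord (fun z => support_combo_subset (hp z.1) (hq z.1) _) fun i => ?_
    have hpi : Continuous fun z : I × I => (p z.1).1 i :=
      (continuous_coord i).comp (p.continuous.comp continuous_fst)
    have hqi : Continuous fun z : I × I => (q z.1).1 i :=
      (continuous_coord i).comp (q.continuous.comp continuous_fst)
    have ht : Continuous fun z : I × I => (z.2 : ℝ) := by fun_prop
    exact ((continuous_const.sub ht).mul hpi).add (ht.mul hqi)
  refine trans_eq_trans_of_square ⟨F, hF⟩ p q _ _ ?_ ?_ ?_ ?_ <;>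
    exact fun t => ext_apply fun i => by simp [F, combo_apply, line_apply]

theorem line_self (p : Realization K) (h : p.Contiguous p) : p.line p h = Path.refl p :=
  Path.ext (funext fun t => ext_apply fun i => by
    rw [line_apply, combo_apply, refl_apply]
    ring)

theorem line_triangle {s : Finset ι} (hs : s ∈ K.faces) {a b c : Realization K}
    (ha : a.1.support ⊆ s) (hb : b.1.support ⊆ s) (hc : c.1.support ⊆ s) (hab : a.Contiguous b)
    (hbc : b.Contiguous c) (hac : a.Contiguous c) :
    (Homotopic.Quotient.mk (a.line b hab)).trans (Homotopic.Quotient.mk (b.line c hbc)) =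
      Homotopic.Quotient.mk (a.line c hac) := by
  have support_line (t : I) : (b.line c hbc t).1.support ⊆ s := support_combo_subset hb hc (t : ℝ)
  rw [← line_square (Path.refl a) (b.line c hbc) (fun _ => ha) support_line
    (fun t => ⟨s, hs, ha, support_line t⟩) hab hac, Homotopic.Quotient.mk_refl,
    Homotopic.Quotient.refl_trans]

theorem line_symm (a b : Realization K) (hab : a.Contiguous b) (hba : b.Contiguous a) :
    (Homotopic.Quotient.mk (a.line b hab)).symm = Homotopic.Quotient.mk (b.line a hba) := by
  obtain ⟨s, hs, ha, hb⟩ := id hab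
  have loop := line_triangle hs ha hb ha hab hba .rfl
  rw [line_self, Homotopic.Quotient.mk_refl] at loop
  rw [← Homotopic.Quotient.trans_refl (Homotopic.Quotient.mk (a.line b hab)).symm, ← loop,
    symm_trans_trans]

end Realization

end RealizationTopology

section Stars

open Realization

variable {ι : Type u} {K : PreAbstractSimplicialComplex ι}

/-- The open star of a vertex. -/
def openStar (K : PreAbstractSimplicialComplex ι) (x : ι) : Set (Realization K) :=
  {p | 0 < p.1 x}

theorem isOpen_openStar (x : ι) : IsOpen (openStar K x) :=
  isOpen_lt continuous_const (continuous_coord x)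

theorem exists_mem_openStar (p : Realization K) : ∃ x, p ∈ openStar K x := by
  by_contra! h
  have hzero : p.1 = 0 := Finsupp.ext fun i => le_antisymm (not_lt.1 (h i)) (p.2.2.1 i)
  simpa [hzero] using p.2.2.2

theorem support_vertex (x : ι) (hx : {x} ∈ K.faces) : (vertex K x hx).1.support = {x} :=
  Finsupp.support_single x one_ne_zero

theorem vertex_mem_openStar (x : ι) (hx : {x} ∈ K.faces) : vertex K x hx ∈ openStar K x := by
  change 0 < Finsupp.single x (1 : ℝ) x
  simp

theorem support_vertex_subset_of_mem_openStar {x : ι} (hx : {x} ∈ K.faces) {p : Realization K}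
    (hp : p ∈ openStar K x) : (vertex K x hx).1.support ⊆ p.1.support := by
  rw [support_vertex, Finset.singleton_subset_iff]
  exact Finsupp.mem_support_iff.2 hp.ne'

theorem contiguous_vertex_of_mem_openStar {x : ι} (hx : {x} ∈ K.faces) {p : Realization K}
    (hp : p ∈ openStar K x) : p.Contiguous (vertex K x hx) :=
  ⟨_, p.2.1, subset_rfl, support_vertex_subset_of_mem_openStar hx hp⟩

theorem line_vertex_mem_openStar {x : ι} (hx : {x} ∈ K.faces) {p : Realization K}
    (hp : p ∈ openStar K x) (h) (t : I) : (vertex K x hx).line p h t ∈ openStar K x := by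
  have h_vertex : 0 < (vertex K x hx).1 x := vertex_mem_openStar x hx
  change 0 < (1 - t : ℝ) * (vertex K x hx).1 x + t * p.1 x
  exact (convex_Ioi (0 : ℝ)) h_vertex hp (sub_nonneg.2 t.2.2) t.2.1 (sub_add_cancel 1 (t : ℝ))

theorem isPathConnected_openStar (x : ι) (hx : {x} ∈ K.faces) : IsPathConnected (openStar K x) :=
  ⟨vertex K x hx, vertex_mem_openStar x hx, fun {_} hp =>
    ⟨(vertex K x hx).line _ (contiguous_vertex_of_mem_openStar hx hp).symm,
      line_vertex_mem_openStar hx hp _⟩⟩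

-- A star may consist of infinitely many simplices, but the product of a quotient map with the
-- locally compact space `I` is again a quotient map.
theorem continuous_combo_vertex (x : ι) (hx : {x} ∈ K.faces) :
    Continuous fun z : openStar K x × I =>
      combo z.1.1 (vertex K x hx) (contiguous_vertex_of_mem_openStar hx z.1.2) z.2 := by
  classical
  let m (z : Σ s : K.faces, stdSimplex ℝ (s : Finset ι)) : Realization K := simplexMap K z.1 z.2
  have hm : Continuous m := isQuotientMap_simplexMap.continuous
  refine (isQuotientMap_simplexMap.restrictPreimage_isOpen
    (isOpen_openStar x)).continuous_lift_prod_left (continuous_iff_continuousAt.2 fun w => ?_)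
  let V : Set (m ⁻¹' openStar K x × I) := {z | z.1.1.1 = w.1.1.1}
  have hV : IsOpen V :=
    (isOpen_sigma_fst_preimage {w.1.1.1}).preimage (continuous_subtype_val.comp continuous_fst)
  refine ContinuousOn.continuousAt (s := V) ?_ (hV.mem_nhds rfl)
  rw [continuousOn_iff_continuous_domRestrict]
  refine continuous_of_coord (T := w.1.1.1.1 ∪ {x}) (fun z => ?_) fun i => ?_
  · refine support_combo_subset ?_ ?_ _
    · exact (extendCoord_support_subset _ _).trans
        ((congrArg Subtype.val z.2).subset.trans Finset.subset_union_left)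
    · exact (support_vertex x hx).subset.trans Finset.subset_union_right
  · have coord_cont : Continuous fun z : V => (m z.1.1.1).1 i := (continuous_coord i).comp
      (hm.comp (continuous_subtype_val.comp (continuous_fst.comp continuous_subtype_val)))
    have time_cont : Continuous fun z : V => (z.1.2 : ℝ) := by fun_prop
    exact ((continuous_const.sub time_cont).mul coord_cont).add (time_cont.mul continuous_const)

theorem mk_trans_line_of_mem_openStar {x : ι} (hx : {x} ∈ K.faces) {a b : Realization K}
    (α : Path a b) (hα : ∀ t, α t ∈ openStar K x) (ha : a.Contiguous (vertex K x hx))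
    (hb : b.Contiguous (vertex K x hx)) :
    (Homotopic.Quotient.mk α).trans (Homotopic.Quotient.mk (b.line (vertex K x hx) hb)) =
      Homotopic.Quotient.mk (a.line (vertex K x hx) ha) := by
  have slide_cont : Continuous fun z : I × I => ((⟨α z.1, hα z.1⟩, z.2) : openStar K x × I) := by
    fun_prop
  rw [trans_eq_trans_of_square ⟨_, (continuous_combo_vertex x hx).comp slide_cont⟩ α
    (Path.refl (vertex K x hx)) (a.line (vertex K x hx) ha) (b.line (vertex K x hx) hb) ?_ ?_ ?_ ?_,
    Homotopic.Quotient.mk_refl, Homotopic.Quotient.trans_refl]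
  all_goals exact fun t => ext_apply fun i => by simp [combo_apply, line_apply]

theorem mk_eq_line_of_mem_openStar {x : ι} (hx : {x} ∈ K.faces) {a : Realization K}
    (α : Path a (vertex K x hx)) (hα : ∀ t, α t ∈ openStar K x)
    (ha : a.Contiguous (vertex K x hx)) :
    Homotopic.Quotient.mk α = Homotopic.Quotient.mk (a.line (vertex K x hx) ha) := by
  rw [← mk_trans_line_of_mem_openStar hx α hα ha .rfl, line_self, Homotopic.Quotient.mk_refl,
    Homotopic.Quotient.trans_refl]

theorem subgroupoid_eq_top_of_line_mem (hK : ∀ x, {x} ∈ K.faces)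
    (S : CategoryTheory.Subgroupoid (FundamentalGroupoidOn fun x => vertex K x (hK x)))
    (hS : ∀ x y (h : (vertex K x (hK x)).Contiguous (vertex K y (hK y))),
      Homotopic.Quotient.mk ((vertex K x (hK x)).line (vertex K y (hK y)) h) ∈ S.arrows x y) :
    S = ⊤ := by
  refine FundamentalGroupoidOn.eq_top_of_openCover S isOpen_openStar exists_mem_openStar
    (fun x => isPathConnected_openStar x (hK x)) (fun x => vertex_mem_openStar x (hK x)) ?_
  intro x y p α β hα hβ
  have hpx : p ∈ openStar K x := hα α.target_mem_range
  have hpy : p ∈ openStar K y := hβ β.source_mem_range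
  have hx := contiguous_vertex_of_mem_openStar (hK x) hpx
  have hy := contiguous_vertex_of_mem_openStar (hK y) hpy
  have α_eq : Homotopic.Quotient.mk α =
      Homotopic.Quotient.mk ((vertex K x (hK x)).line p hx.symm) := by
    rw [← line_symm _ _ hx, ← mk_eq_line_of_mem_openStar (hK x) α.symm
      (fun t => hα (mem_range_self _)) hx, Homotopic.Quotient.mk_symm, symm_symm_class]
  have β_eq : Homotopic.Quotient.mk β =
      Homotopic.Quotient.mk (p.line (vertex K y (hK y)) hy) :=
    mk_eq_line_of_mem_openStar (hK y) β (fun t => hβ (mem_range_self t)) hy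
  have hxs := support_vertex_subset_of_mem_openStar (hK x) hpx
  have hys := support_vertex_subset_of_mem_openStar (hK y) hpy
  rw [α_eq, β_eq, line_triangle p.2.1 hxs subset_rfl hys _ _ ⟨_, p.2.1, hxs, hys⟩]
  exact hS x y _

end Stars

section LocalMinima

theorem forall_of_forall_isLocalMin {Z : Type*} [TopologicalSpace Z] [CompactSpace Z] {f : Z → ℝ}
    (hf : Continuous f) {r : ℝ} {P : Z → Prop}
    (hP : ∀ m, f m < r → ∀ᶠ z in 𝓝 m, P z ↔ P m) (hmin : ∀ m, f m < r → IsLocalMin f m → P m) :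
    ∀ z, f z < r → P z := by
  by_contra! ⟨z, hzr, hz⟩
  obtain ⟨m, hm, hm_le⟩ := (isClosed_closure (s := {z | f z < r ∧ ¬ P z})).isCompact.exists_isMinOn
    ⟨z, subset_closure ⟨hzr, hz⟩⟩ hf.continuousOn
  have hmr : f m < r := (hm_le (subset_closure ⟨hzr, hz⟩)).trans_lt hzr
  have hPm : ¬ P m := by
    obtain ⟨z', ⟨-, hz'⟩, hiff⟩ :=
      ((mem_closure_iff_frequently.1 hm).and_eventually (hP m hmr)).exists
    exact fun h => hz' (hiff.2 h)
  refine hPm (hmin m hmr ?_)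
  filter_upwards [hP m hmr] with z' hiff
  by_cases hr : f z' < r
  · exact hm_le (subset_closure ⟨hr, fun h => hPm (hiff.1 h)⟩)
  · exact hmr.le.trans (not_lt.1 hr)

end LocalMinima

section Edges

open Realization

variable {X : Type u} [MetricSpace X] {r : ℝ}

theorem mem_rips_of_dist_lt {s : Finset X} (hs : s.Nonempty)
    (h : ∀ x ∈ s, ∀ y ∈ s, dist x y < r) : s ∈ (Rips X r).faces := by
  obtain ⟨m, hm, hmax⟩ := (s ×ˢ s).exists_max_image (fun q : X × X => dist q.1 q.2) (hs.product hs)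
  rw [Finset.mem_product] at hm
  refine ⟨hs, (Metric.diam_le_of_forall_dist_le dist_nonneg fun x hx y hy => ?_).trans_lt
    (h m.1 hm.1 m.2 hm.2)⟩
  exact hmax (x, y) (Finset.mem_product.2 ⟨hx, hy⟩)

theorem support_ripsPoint (hr : 0 < r) (x : X) : (ripsPoint X hr x).1.support = {x} :=
  support_vertex _ _

theorem contiguous_ripsPoint (hr : 0 < r) {x y : X} (h : dist x y < r) :
    (ripsPoint X hr x).Contiguous (ripsPoint X hr y) := by
  classical
  refine ⟨{x, y}, mem_rips_of_dist_lt (by simp) ?_, ?_, ?_⟩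
  · simp [hr, h, dist_comm y x]
  all_goals simp [support_ripsPoint]

theorem dist_lt_of_contiguous_ripsPoint (hr : 0 < r) {x y : X}
    (h : (ripsPoint X hr x).Contiguous (ripsPoint X hr y)) : dist x y < r := by
  obtain ⟨s, hs, hx, hy⟩ := h
  rw [support_ripsPoint, Finset.singleton_subset_iff] at hx hy
  exact (Metric.dist_le_diam_of_mem s.finite_toSet.isBounded hx hy).trans_lt hs.2

/-- The class of the edge of the Rips complex between two points of distance less than `r`. -/
def edge (hr : 0 < r) (x y : X) (h : dist x y < r) :
    Homotopic.Quotient (ripsPoint X hr x) (ripsPoint X hr y) :=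
  Homotopic.Quotient.mk ((ripsPoint X hr x).line (ripsPoint X hr y) (contiguous_ripsPoint hr h))

theorem edge_trans (hr : 0 < r) {x y z : X} (hxy : dist x y < r) (hyz : dist y z < r)
    (hxz : dist x z < r) : (edge hr x y hxy).trans (edge hr y z hyz) = edge hr x z hxz := by
  classical
  refine line_triangle (s := {x, y, z}) (mem_rips_of_dist_lt (by simp) ?_) ?_ ?_ ?_ _ _ _
  · simp [hr, hxy, hyz, hxz, dist_comm y x, dist_comm z x, dist_comm z y]
  all_goals simp [support_ripsPoint]

theorem edge_symm (hr : 0 < r) {x y : X} (hxy : dist x y < r) (hyx : dist y x < r) :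
    (edge hr x y hxy).symm = edge hr y x hyx :=
  line_symm _ _ _ _

variable {hr : 0 < r} {S : CategoryTheory.Subgroupoid (FundamentalGroupoidOn (ripsPoint X hr))}
  {ε : ℝ}

theorem edge_mem_iff_left {x x' y : X} {hx : dist x x' < r} (hS : edge hr x x' hx ∈ S.arrows x x')
    (h : dist x y < r) (h' : dist x' y < r) :
    edge hr x' y h' ∈ S.arrows x' y ↔ edge hr x y h ∈ S.arrows x y := by
  rw [← edge_trans hr hx h' h]
  exact (S.mul_mem_cancel_left hS).symm

theorem edge_mem_iff_right {x y y' : X} {hy : dist y y' < r} (hS : edge hr y y' hy ∈ S.arrows y y')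
    (h : dist x y < r) (h' : dist x y' < r) :
    edge hr x y' h' ∈ S.arrows x y' ↔ edge hr x y h ∈ S.arrows x y := by
  rw [← edge_trans hr h hy h']
  exact S.mul_mem_cancel_right hS

theorem eventually_edge_mem_iff (hε : 0 < ε)
    (short : ∀ (x y : X) (h : dist x y < r), dist x y < ε → edge hr x y h ∈ S.arrows x y)
    (m : X × X) (hm : dist m.1 m.2 < r) :
    ∀ᶠ z in 𝓝 m, (∀ h : dist z.1 z.2 < r, edge hr z.1 z.2 h ∈ S.arrows z.1 z.2) ↔
      ∀ h : dist m.1 m.2 < r, edge hr m.1 m.2 h ∈ S.arrows m.1 m.2 := by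
  have near_dist : ∀ᶠ z in 𝓝 m, dist z.1 z.2 < r :=
    continuous_dist.continuousAt.eventually_lt_const hm
  have near_mixed : ∀ᶠ z in 𝓝 m, dist z.1 m.2 < r :=
    (continuous_fst.dist continuous_const).continuousAt.eventually_lt_const hm
  filter_upwards [near_dist, near_mixed, Metric.ball_mem_nhds m (lt_min hε hr)] with z hz hzm hball
  rw [Metric.mem_ball', Prod.dist_eq, max_lt_iff, lt_min_iff, lt_min_iff] at hball
  obtain ⟨⟨hε₁, hr₁⟩, hε₂, hr₂⟩ := hball
  rw [forall_prop_of_true hz, forall_prop_of_true hm,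
    edge_mem_iff_right (short _ _ hr₂ hε₂) hzm hz, edge_mem_iff_left (short _ _ hr₁ hε₁) hm hzm]

theorem edge_mem_of_minPairs [CompactSpace X] (hε : 0 < ε)
    (short : ∀ (x y : X) (h : dist x y < r), dist x y < ε → edge hr x y h ∈ S.arrows x y)
    (min_mem : ∀ (x y : X) (h : dist x y < r), 0 < dist x y → (x, y) ∈ minPairs X (dist x y) →
      edge hr x y h ∈ S.arrows x y) (x y : X) (h : dist x y < r) :
    edge hr x y h ∈ S.arrows x y := by
  refine forall_of_forall_isLocalMin (f := fun z : X × X => dist z.1 z.2) continuous_dist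
    (P := fun z => ∀ h : dist z.1 z.2 < r, edge hr z.1 z.2 h ∈ S.arrows z.1 z.2)
    (eventually_edge_mem_iff hε short) (fun m _ hm h => ?_) (x, y) h h
  by_cases h_short : dist m.1 m.2 < ε
  · exact short _ _ h h_short
  · exact min_mem _ _ h (hε.trans_le (not_lt.1 h_short)) ⟨rfl, hm⟩

theorem eq_top_of_edge_mem
    (hS : ∀ (x y : X) (h : dist x y < r), edge hr x y h ∈ S.arrows x y) : S = ⊤ :=
  subgroupoid_eq_top_of_line_mem (singleton_mem_rips X hr) S
    fun x y h => hS x y (dist_lt_of_contiguous_ripsPoint hr h)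

end Edges

section FineMaps

open Realization

/-- The map to the realization of `K` whose barycentric coordinates are a given partition of
unity. -/
def partitionOfUnityMap {ι : Type u} {K : PreAbstractSimplicialComplex ι} {Z : Type*}
    [TopologicalSpace Z] (ρ : PartitionOfUnity ι Z) (hρ : ∀ z, ρ.finsupport z ∈ K.faces) (z : Z) :
    Realization K :=
  let f : ι →₀ ℝ := Finsupp.onFinset (ρ.finsupport z) (fun i => ρ i z)
    fun i hi => (ρ.mem_finsupport z).2 hi
  ⟨f, by
    have hf : f.support = ρ.finsupport z := by ext i; simp [f]
    refine ⟨hf ▸ hρ z, fun i => ρ.nonneg i z, ?_⟩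
    rw [Finsupp.sum, hf]
    exact ρ.sum_finsupport (mem_univ z)⟩

theorem continuous_partitionOfUnityMap {ι : Type u} {K : PreAbstractSimplicialComplex ι}
    {Z : Type*} [TopologicalSpace Z] [CompactSpace Z] (ρ : PartitionOfUnity ι Z)
    (hρ : ∀ z, ρ.finsupport z ∈ K.faces) : Continuous (partitionOfUnityMap ρ hρ) := by
  have finite_nonempty := ρ.locallyFinite.finite_nonempty_of_compact
  refine continuous_of_coord (T := finite_nonempty.toFinset) (fun z i hi => ?_)
    fun i => (ρ i).continuous
  exact finite_nonempty.mem_toFinset.2 ⟨z, Finsupp.mem_support_iff.1 hi⟩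

/-- A continuous map from `X` to its Rips complex which moves points by less than `r / 4` and
involves only the finitely many vertices in `net`. -/
structure FineMap (X : Type u) [MetricSpace X] (r : ℝ) where
  map : C(X, RipsSpace X r)
  net : Finset X
  support_subset : ∀ x, (map x).1.support ⊆ net
  dist_lt : ∀ x, ∀ i ∈ (map x).1.support, dist x i < r / 4

variable {X : Type u} [MetricSpace X] {r : ℝ}

theorem exists_fineMap [CompactSpace X] (hr : 0 < r) : Nonempty (FineMap X r) := by
  have hr4 : 0 < r / 4 := by positivity
  obtain ⟨ρ, hρ⟩ := PartitionOfUnity.exists_isSubordinate isClosed_univ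
    (fun x : X => Metric.ball x (r / 4)) (fun x => Metric.isOpen_ball)
    fun x _ => mem_iUnion.2 ⟨x, Metric.mem_ball_self hr4⟩
  have dist_lt {x i : X} (hi : ρ i x ≠ 0) : dist x i < r / 4 := hρ i (subset_tsupport _ hi)
  have finsupport_mem (x : X) : ρ.finsupport x ∈ (Rips X r).faces := by
    obtain ⟨i, hi⟩ := ρ.exists_pos (mem_univ x)
    refine mem_rips_of_dist_lt ⟨i, (ρ.mem_finsupport x).2 hi.ne'⟩ fun y hy z hz => ?_
    have hy := dist_lt ((ρ.mem_finsupport x).1 hy)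
    have hz := dist_lt ((ρ.mem_finsupport x).1 hz)
    linarith [dist_triangle_left y z x]
  have hcont := continuous_partitionOfUnityMap ρ finsupport_mem
  refine ⟨⟨⟨_, hcont⟩, ρ.locallyFinite.finite_nonempty_of_compact.toFinset, fun x i hi => ?_,
    fun x i hi => dist_lt (Finsupp.mem_support_iff.1 hi)⟩⟩
  exact (Finite.mem_toFinset _).2 ⟨x, Finsupp.mem_support_iff.1 hi⟩

namespace FineMap

variable (φ : FineMap X r) (hr : 0 < r)

theorem contiguous_of_near {p : RipsSpace X r} {x y : X}
    (hp : ∀ i ∈ p.1.support, dist x i < r / 4) (hxy : dist x y < r / 4) :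
    p.Contiguous (φ.map y) := by
  classical
  have near {i : X} (hi : i ∈ p.1.support ∪ (φ.map y).1.support) : dist x i < r / 2 := by
    rcases Finset.mem_union.1 hi with hi | hi
    · linarith [hp i hi, dist_nonneg (x := x) (y := i)]
    · linarith [φ.dist_lt y i hi, dist_triangle x y i]
  refine ⟨p.1.support ∪ (φ.map y).1.support,
    mem_rips_of_dist_lt (p.2.1.1.mono Finset.subset_union_left) fun i hi j hj => ?_,
    Finset.subset_union_left, Finset.subset_union_right⟩
  linarith [near hi, near hj, dist_triangle_left i j x]

theorem contiguous_ripsPoint (x : X) : (ripsPoint X hr x).Contiguous (φ.map x) :=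
  φ.contiguous_of_near (x := x) (by simpa [support_ripsPoint] using hr) (by simpa using hr)

/-- The class of the straight path from the vertex `x` to the image of the point `x`. -/
def spoke (x : X) : Homotopic.Quotient (ripsPoint X hr x) (φ.map x) :=
  Homotopic.Quotient.mk ((ripsPoint X hr x).line (φ.map x) (φ.contiguous_ripsPoint hr x))

theorem edge_trans_spoke {x y : X} (p : Path x y) (hp : ∀ t, dist x (p t) < r / 4)
    (h : dist x y < r) :
    (edge hr x y h).trans (φ.spoke hr y) =
      (φ.spoke hr x).trans ((Homotopic.Quotient.mk p).map φ.map) := by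
  classical
  let l := (ripsPoint X hr x).line (ripsPoint X hr y) (RipsMin.contiguous_ripsPoint hr h)
  have hl (t) : (l t).1.support ⊆ {x, y} :=
    support_combo_subset (by simp [support_ripsPoint]) (by simp [support_ripsPoint]) (t : ℝ)
  refine line_square (T := {x, y} ∪ φ.net) l (p.map φ.map.continuous)
    (fun t => (hl t).trans Finset.subset_union_left)
    (fun t => (φ.support_subset (p t)).trans Finset.subset_union_right)
    (fun t => φ.contiguous_of_near (fun i hi => ?_) (hp t)) _ _
  rcases Finset.mem_insert.1 (hl t hi) with rfl | hi
  · simpa using hp 0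
  · rw [Finset.mem_singleton.1 hi]
    simpa using hp 1

theorem exists_joined (p : RipsSpace X r) : ∃ x, Joined (φ.map x) p := by
  have hr : 0 < r := Metric.diam_nonneg.trans_lt p.2.1.2
  obtain ⟨x, hx⟩ := exists_mem_openStar p
  have toVertex := contiguous_vertex_of_mem_openStar (singleton_mem_rips X hr x) hx
  exact ⟨x, (joined_of_pathClass (φ.spoke hr x)).symm.trans ⟨line _ _ toVertex.symm⟩⟩

end FineMap

end FineMaps

section Conjugation

open CategoryTheory

variable {Y J : Type*} [TopologicalSpace Y] {w w' : J → Y}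

namespace FundamentalGroupoidOn

/-- The subgroupoid on the base points `w` which corresponds to `S` under a change of base points
along the path classes `l`. -/
def changeBase (l : ∀ j, Homotopic.Quotient (w j) (w' j))
    (S : Subgroupoid (FundamentalGroupoidOn w')) : Subgroupoid (FundamentalGroupoidOn w) where
  arrows i j := {p | ((l i).symm.trans p).trans (l j) ∈ S.arrows i j}
  inv {i j p} hp := by
    change ((l j).symm.trans (Homotopic.Quotient.symm p)).trans (l i) ∈ S.arrows j i
    simpa [Homotopic.Quotient.trans_assoc] using symm_mem hp
  mul {i j k p} hp {q} hq := by
    change ((l i).symm.trans (Homotopic.Quotient.trans p q)).trans (l k) ∈ S.arrows i k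
    simpa [Homotopic.Quotient.trans_assoc] using trans_mem hp hq

theorem mem_changeBase {l : ∀ j, Homotopic.Quotient (w j) (w' j)}
    {S : Subgroupoid (FundamentalGroupoidOn w')} {i j : J} {p : Homotopic.Quotient (w i) (w j)} :
    p ∈ (changeBase l S).arrows i j ↔ ((l i).symm.trans p).trans (l j) ∈ S.arrows i j :=
  Iff.rfl

theorem eq_top_of_changeBase_eq_top {l : ∀ j, Homotopic.Quotient (w j) (w' j)}
    {S : Subgroupoid (FundamentalGroupoidOn w')} (h : changeBase l S = ⊤) : S = ⊤ := by
  refine top_unique ((Subgroupoid.le_iff _ _).2 fun {i j} γ _ => ?_)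
  have hγ : (((l i).trans γ).trans (l j).symm) ∈ (changeBase l S).arrows i j :=
    h ▸ Subgroupoid.mem_top _
  simpa [Homotopic.Quotient.trans_assoc] using mem_changeBase.1 hγ

end FundamentalGroupoidOn

end Conjugation

section MinimalEdges

theorem exists_forall_joinedIn_ball (X : Type*) [PseudoMetricSpace X] [CompactSpace X]
    [LocallyPathConnectedSpace X] {δ : ℝ} (hδ : 0 < δ) :
    ∃ ε > 0, ∀ x y : X, dist x y < ε → JoinedIn (Metric.ball x δ) x y := by
  let V (i : X) : Set X := pathComponentIn (Metric.ball i (δ / 2)) i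
  have hmem (i : X) : i ∈ V i := mem_pathComponentIn_self (Metric.mem_ball_self (half_pos hδ))
  obtain ⟨ε, hε, hV⟩ := lebesgue_number_lemma_of_metric isCompact_univ
    (fun i => (Metric.isOpen_ball (x := i) (ε := δ / 2)).pathComponentIn i)
    fun x _ => mem_iUnion.2 ⟨x, hmem x⟩
  refine ⟨ε, hε, fun x y hxy => ?_⟩
  obtain ⟨i, hi⟩ := hV x (mem_univ x)
  have hx : JoinedIn (Metric.ball i (δ / 2)) i x := hi (Metric.mem_ball_self hε)
  have hy : JoinedIn (Metric.ball i (δ / 2)) i y := hi (Metric.mem_ball'.2 hxy)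
  refine (hx.symm.trans hy).mono fun z hz => ?_
  have hz := Metric.mem_ball.1 hz
  have hx := Metric.mem_ball.1 hx.target_mem
  exact Metric.mem_ball.2 (by linarith [dist_triangle_right z x i])

/-- The edges of length less than `r` at which the distance function has a positive local
minimum. -/
def minEdgesBelow (X : Type u) [MetricSpace X] (r : ℝ) : Set (Sym2 X) :=
  ⋃ c ∈ Ioo 0 r, minEdges X c

variable {X : Type u} [MetricSpace X] {r : ℝ}

theorem dist_out_lt (k : minEdgesBelow X r) : dist k.1.out.1 k.1.out.2 < r := by
  obtain ⟨c, ⟨-, hc⟩, ⟨x, y⟩, ⟨rfl, -⟩, hxy⟩ := mem_iUnion₂.1 k.2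
  rcases Sym2.eq_iff.1 (hxy.trans k.1.out_eq.symm) with ⟨hx, hy⟩ | ⟨hx, hy⟩
  · exact hx ▸ hy ▸ hc
  · exact hx ▸ hy ▸ dist_comm x y ▸ hc

theorem mem_minEdgesBelow {x y : X} (h : dist x y < r) (h₀ : 0 < dist x y)
    (hmin : (x, y) ∈ minPairs X (dist x y)) : s(x, y) ∈ minEdgesBelow X r :=
  mem_iUnion₂.2 ⟨dist x y, ⟨h₀, h⟩, (x, y), hmin, rfl⟩

theorem edge_mem_of_sym2_eq {hr : 0 < r}
    {S : CategoryTheory.Subgroupoid (FundamentalGroupoidOn (ripsPoint X hr))} {x y x' y' : X}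
    {h : dist x y < r} (hS : edge hr x y h ∈ S.arrows x y) (heq : s(x, y) = s(x', y'))
    (h' : dist x' y' < r) : edge hr x' y' h' ∈ S.arrows x' y' := by
  rcases Sym2.eq_iff.1 heq with ⟨rfl, rfl⟩ | ⟨rfl, rfl⟩
  · exact hS
  · rw [← edge_symm hr h]
    exact FundamentalGroupoidOn.symm_mem hS

namespace FineMap

variable (φ : FineMap X r) (hr : 0 < r)

/-- The class of the path in the Rips complex along the edge `k`, between the images of its end
points. The orientation of `k` is chosen arbitrarily. -/
def minEdgeClass (k : minEdgesBelow X r) :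
    Homotopic.Quotient (φ.map k.1.out.1) (φ.map k.1.out.2) :=
  ((φ.spoke hr _).symm.trans (edge hr _ _ (dist_out_lt k))).trans (φ.spoke hr _)

theorem pathGeneratedBy [CompactSpace X] [LocallyPathConnectedSpace X] :
    PathGeneratedBy φ.map (φ.minEdgeClass hr) where
  exists_joined := φ.exists_joined
  eq_top S map_mem mem := by
    obtain ⟨ε, hε, hjoined⟩ := exists_forall_joinedIn_ball X (δ := r / 4) (by positivity)
    refine FundamentalGroupoidOn.eq_top_of_changeBase_eq_top (l := φ.spoke hr)
      (eq_top_of_edge_mem (edge_mem_of_minPairs hε (fun x y h hxy => ?_) fun x y h h₀ hmin => ?_))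
    · obtain ⟨p, hp⟩ := hjoined x y hxy
      rw [FundamentalGroupoidOn.mem_changeBase, Homotopic.Quotient.trans_assoc,
        φ.edge_trans_spoke hr p (fun t => Metric.mem_ball'.1 (hp t)), symm_trans_trans]
      exact map_mem x y _
    · let k : minEdgesBelow X r := ⟨s(x, y), mem_minEdgesBelow h h₀ hmin⟩
      exact edge_mem_of_sym2_eq (FundamentalGroupoidOn.mem_changeBase.2 (mem k)) k.1.out_eq h

end FineMap

end MinimalEdges

section TotallyDisconnected

theorem mgs_eq_zero (G : Type*) [Group G] [Subsingleton G] : mgs G = 0 :=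
  le_zero_iff.1 ((mgs_le (S := ∅) (Subsingleton.elim _ _)).trans encard_empty.le)

theorem mgsModule_eq_zero (A : Type*) [CommRing A] (M : Type*) [AddCommGroup M] [Module A M]
    [Subsingleton M] : mgsModule A M = 0 :=
  le_zero_iff.1 ((mgsModule_le (S := ∅) (Subsingleton.elim _ _)).trans encard_empty.le)

variable (T : Type u) [TopologicalSpace T] [TotallyDisconnectedSpace T]

theorem subsingleton_fundamentalGroup (a : T) : Subsingleton (FundamentalGroup T a) := by
  have path_eq_refl (p : Path a a) : p = Path.refl a := Path.ext (funext fun t =>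
    (isPreconnected_range p.continuous).subsingleton (mem_range_self t) p.source_mem_range)
  refine ⟨fun g h => ?_⟩
  obtain ⟨p, hp⟩ := Homotopic.Quotient.mk_surjective (FundamentalGroup.toPath g)
  obtain ⟨q, hq⟩ := Homotopic.Quotient.mk_surjective (FundamentalGroup.toPath h)
  rw [path_eq_refl p] at hp
  rw [path_eq_refl q] at hq
  exact hp.symm.trans hq

theorem MGS_eq_zero : MGS T = 0 := by
  have mgs_eq_zero (j : ZerothHomotopy T) : mgs (FundamentalGroup T (Quotient.out j)) = 0 :=
    have := subsingleton_fundamentalGroup T (Quotient.out j)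
    mgs_eq_zero _
  simp [MGS, mgs_eq_zero]

theorem mgsModule_H1_eq_zero (A : Type v) [CommRing A] : mgsModule A (H1 A T) = 0 := by
  have := ModuleCat.subsingleton_of_isZero
    (AlgebraicTopology.isZero_singularHomologyFunctor_of_totallyDisconnectedSpace
      (ModuleCat.{max u v} A) 1 (ModuleCat.of A (ULift.{u} A)) (TopCat.of T) one_ne_zero)
  exact mgsModule_eq_zero _ _

end TotallyDisconnected

section Finiteness

/-- Every point of `Y` has a neighbourhood in which any two paths with the same end points are
homotopic in `Y`, by a homotopy which may leave the neighbourhood. -/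
def SemilocallySimplyConnected (Y : Type*) [TopologicalSpace Y] : Prop :=
  ∀ y : Y, ∃ U ∈ 𝓝 y, ∀ (a b : Y) (p q : Path a b), range p ⊆ U → range q ⊆ U → p.Homotopic q

variable {X : Type u} [MetricSpace X]

/-- The points which can be joined to `x` in the ball of radius `ε` about `x`. -/
def pathBall (x : X) (ε : ℝ) : Set X :=
  pathComponentIn (Metric.ball x ε) x

theorem pathBall_subset_ball (x : X) (ε : ℝ) : pathBall x ε ⊆ Metric.ball x ε :=
  pathComponentIn_subset

theorem mem_pathBall_self (x : X) {ε : ℝ} (hε : 0 < ε) : x ∈ pathBall x ε :=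
  mem_pathComponentIn_self (Metric.mem_ball_self hε)

theorem isOpen_pathBall [LocallyPathConnectedSpace X] (x : X) (ε : ℝ) : IsOpen (pathBall x ε) :=
  Metric.isOpen_ball.pathComponentIn x

theorem isPathConnected_pathBall (x : X) {ε : ℝ} (hε : 0 < ε) : IsPathConnected (pathBall x ε) :=
  isPathConnected_pathComponentIn (Metric.mem_ball_self hε)

theorem range_trans_subset_ball {ε : ℝ} {i j y : X} {α : Path i y} {β : Path y j}
    (hα : range α ⊆ pathBall i ε) (hβ : range β ⊆ pathBall j ε) :
    range (α.trans β) ⊆ Metric.ball i (3 * ε) := by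
  have hi : dist y i < ε := pathBall_subset_ball i ε (hα α.target_mem_range)
  have hj : dist y j < ε := pathBall_subset_ball j ε (hβ β.source_mem_range)
  have hε : 0 < ε := dist_nonneg.trans_lt hi
  rw [Path.trans_range]
  refine union_subset (fun z hz => ?_) fun z hz => ?_ <;> rw [Metric.mem_ball]
  · have hz : dist z i < ε := pathBall_subset_ball i ε (hα hz)
    linarith
  · have hz : dist z j < ε := pathBall_subset_ball j ε (hβ hz)
    linarith [dist_triangle z j i, dist_triangle_left j i y]

theorem SemilocallySimplyConnected.exists_radius [CompactSpace X]
    (h : SemilocallySimplyConnected X) : ∃ ε > 0, ∀ (i j y z : X) (α : Path i y) (β : Path y j)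
      (α' : Path i z) (β' : Path z j), range α ⊆ pathBall i ε → range β ⊆ pathBall j ε →
      range α' ⊆ pathBall i ε → range β' ⊆ pathBall j ε → (α.trans β).Homotopic (α'.trans β') := by
  choose U hU homotopic using h
  obtain ⟨δ, hδ, hball⟩ := lebesgue_number_lemma_of_metric isCompact_univ
    (fun x => isOpen_interior (s := U x)) fun x _ =>
      mem_iUnion.2 ⟨x, mem_interior_iff_mem_nhds.2 (hU x)⟩
  refine ⟨δ / 3, by positivity, fun i j y z α β α' β' hα hβ hα' hβ' => ?_⟩
  obtain ⟨x, hx⟩ := hball i (mem_univ i)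
  have ball_subset : Metric.ball i (3 * (δ / 3)) ⊆ U x := by
    rw [mul_div_cancel₀ δ three_ne_zero]
    exact hx.trans interior_subset
  exact homotopic x i j _ _ ((range_trans_subset_ball hα hβ).trans ball_subset)
    ((range_trans_subset_ball hα' hβ').trans ball_subset)

theorem SemilocallySimplyConnected.exists_finite_pathGeneratedBy [CompactSpace X]
    [LocallyPathConnectedSpace X] (h : SemilocallySimplyConnected X) :
    ∃ (T : Finset X) (K : Set (T × T)) (s t : K → T)
      (e : ∀ k, Homotopic.Quotient (s k : X) (t k)),
      PathGeneratedBy (X := T) ⟨Subtype.val, continuous_subtype_val⟩ e := by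
  obtain ⟨ε, hε, homotopic⟩ := h.exists_radius
  obtain ⟨T, -, hT⟩ := isCompact_univ.elim_nhds_subcover (fun x : X => pathBall x ε)
    fun x _ => (isOpen_pathBall x ε).mem_nhds (mem_pathBall_self x hε)
  have cover (y : X) : ∃ i : T, y ∈ pathBall (i : X) ε :=
    let ⟨i, hi, hy⟩ := mem_iUnion₂.1 (hT (mem_univ y))
    ⟨⟨i, hi⟩, hy⟩
  let K : Set (T × T) := {k | ∃ (y : X) (α : Path (k.1 : X) y) (β : Path y (k.2 : X)),
    range α ⊆ pathBall (k.1 : X) ε ∧ range β ⊆ pathBall (k.2 : X) ε}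
  choose y α β hα hβ using fun k : K => k.2
  refine ⟨T, K, fun k => k.1.1, fun k => k.1.2,
    fun k => Homotopic.Quotient.mk ((α k).trans (β k)), fun y => ?_, fun S _ mem => ?_⟩
  · obtain ⟨i, hi⟩ := cover y
    exact ⟨i, ((isPathConnected_pathBall _ hε).joinedIn _ (mem_pathBall_self _ hε) _ hi).joined⟩
  · refine FundamentalGroupoidOn.eq_top_of_openCover S (fun i : T => isOpen_pathBall (i : X) ε)
      cover (fun i => isPathConnected_pathBall _ hε) (fun i => mem_pathBall_self _ hε) ?_
    intro i j z α' β' hα' hβ'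
    let k : K := ⟨(i, j), z, α', β', hα', hβ'⟩
    rw [← Homotopic.Quotient.mk_trans, Homotopic.Quotient.eq.2
      (homotopic i j z (y k) α' β' (α k) (β k) hα' hβ' (hα k) (hβ k))]
    exact mem k

namespace SemilocallySimplyConnected

variable [CompactSpace X] [LocallyPathConnectedSpace X]

theorem finite_zerothHomotopy (h : SemilocallySimplyConnected X) :
    Finite (ZerothHomotopy X) := by
  obtain ⟨T, K, s, t, e, he⟩ := h.exists_finite_pathGeneratedBy
  exact he.finite_zerothHomotopy

theorem MGS_lt_top (h : SemilocallySimplyConnected X) : MGS X < ⊤ := by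
  obtain ⟨T, K, s, t, e, he⟩ := h.exists_finite_pathGeneratedBy
  exact he.MGS_le.trans_lt (by simpa [MGS_eq_zero] using toFinite K)

theorem mgsModule_H1_lt_top (h : SemilocallySimplyConnected X) (A : Type v) [CommRing A] :
    mgsModule A (H1 A X) < ⊤ := by
  obtain ⟨T, K, s, t, e, he⟩ := h.exists_finite_pathGeneratedBy
  exact (he.mgsModule_H1_le A).trans_lt
    (by simpa [mgsModule_H1_eq_zero] using toFinite K)

end SemilocallySimplyConnected

end Finiteness

section SimplyConnectedBalls

theorem homotopic_of_isSimplyConnected {Y : Type*} [TopologicalSpace Y] {U : Set Y}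
    (hU : IsSimplyConnected U) {a b : Y} (p q : Path a b) (hp : range p ⊆ U) (hq : range q ⊆ U) :
    p.Homotopic q := by
  have := hU.simplyConnectedSpace
  let lift (γ : Path a b) (hγ : range γ ⊆ U) :
      Path (⟨a, hp p.source_mem_range⟩ : U) ⟨b, hp p.target_mem_range⟩ :=
    ⟨⟨fun t => ⟨γ t, hγ (mem_range_self t)⟩, by fun_prop⟩, by simp, by simp⟩
  exact (SimplyConnectedSpace.paths_homotopic (lift p hp) (lift q hq)).map
    ⟨Subtype.val, continuous_subtype_val⟩

namespace SimplyConnectedUpTo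

variable {X : Type u} [MetricSpace X] {R : ℝ}

theorem locallyPathConnectedSpace (hR : 0 < R) (h : SimplyConnectedUpTo X R) :
    LocallyPathConnectedSpace X :=
  .of_bases (p := fun _ ε => 0 < ε ∧ ε < R)
    (fun _ => Metric.nhds_basis_ball.restrict fun ε hε => ⟨min ε (R / 2),
      lt_min hε (half_pos hR), (min_le_right _ _).trans_lt (half_lt_self hR),
      Metric.ball_subset_ball (min_le_left _ _)⟩)
    fun x ε hε => (h x ε hε.1 hε.2).isPathConnected

theorem semilocallySimplyConnected (hR : 0 < R) (h : SimplyConnectedUpTo X R) :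
    SemilocallySimplyConnected X := fun x =>
  ⟨Metric.ball x (R / 2), Metric.ball_mem_nhds x (half_pos hR), fun _ _ p q =>
    homotopic_of_isSimplyConnected (h x (R / 2) (half_pos hR) (half_lt_self hR)) p q⟩

end SimplyConnectedUpTo

end SimplyConnectedBalls

section CountingMinimalEdges

variable {X : Type u} [MetricSpace X]

theorem minEdgesBelow_eq_biUnion (hmin : (LocMin X).Finite) (r : ℝ) :
    minEdgesBelow X r = ⋃ c ∈ hmin.toFinset.filter (fun c => 0 < c ∧ c < r), minEdges X c := by
  ext k
  simp only [minEdgesBelow, mem_iUnion₂, exists_prop, Finset.mem_filter, Finite.mem_toFinset]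
  constructor
  · rintro ⟨c, hc, p, hp, hk⟩
    exact ⟨c, ⟨⟨p, hp⟩, hc⟩, p, hp, hk⟩
  · rintro ⟨c, ⟨-, hc⟩, hk⟩
    exact ⟨c, hc, hk⟩

theorem pairwise_disjoint_minEdges : Pairwise (Function.onFun Disjoint (minEdges X)) := by
  intro c c' hcc
  refine disjoint_left.2 ?_
  rintro _ ⟨⟨x, y⟩, ⟨rfl, -⟩, rfl⟩ ⟨⟨x', y'⟩, ⟨rfl, -⟩, h⟩
  rcases Sym2.eq_iff.1 h with ⟨rfl, rfl⟩ | ⟨rfl, rfl⟩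
  · exact hcc rfl
  · exact hcc (dist_comm _ _)

theorem encard_minEdgesBelow (hmin : (LocMin X).Finite) (r : ℝ) :
    (minEdgesBelow X r).encard = numMinEdges X hmin r := by
  rw [minEdgesBelow_eq_biUnion hmin, numMinEdges, ← finsum_mem_coe_finset]
  exact (Finset.finite_toSet _).encard_biUnion (pairwise_disjoint_minEdges.set_pairwise _)

theorem finite_minEdgesBelow (hmin : (LocMin X).Finite)
    (hfin : ∀ c : ℝ, 0 < c → (minPairs X c).Finite) (r : ℝ) : (minEdgesBelow X r).Finite := by
  rw [minEdgesBelow_eq_biUnion hmin]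
  exact Finset.finite_toSet _ |>.biUnion fun c hc => (hfin c (Finset.mem_filter.1 hc).2.1).image _

end CountingMinimalEdges

end RipsMin

end

open RipsMin in
theorem theorem4p13_general {X : Type u} [MetricSpace X] [CompactSpace X]
    [LocallyPathConnectedSpace X] (hX : SemilocallySimplyConnected X) (x₀ : X)
    (A : Type v) [CommRing A] {r : ℝ} (hr : 0 < r) (hfin : (minEdgesBelow X r).Finite) :
    (mgsModule A (H1 A (RipsSpace X r)) ≤ mgsModule A (H1 A X) + (minEdgesBelow X r).encard ∧
      mgsModule A (H1 A X) + (minEdgesBelow X r).encard < ⊤) ∧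
    (MGS (RipsSpace X r) ≤ MGS X + (minEdgesBelow X r).encard ∧
      MGS X + (minEdgesBelow X r).encard < ⊤) ∧
    mgs (FundamentalGroup (RipsSpace X r) (ripsPoint X hr x₀)) ≤
      MGS X + (minEdgesBelow X r).encard := by
  obtain ⟨φ⟩ := exists_fineMap (X := X) hr
  have generated := φ.pathGeneratedBy hr
  have := hX.finite_zerothHomotopy
  have := generated.finite_zerothHomotopy
  have h1_le := generated.mgsModule_H1_le A
  have mgs_le := generated.MGS_le
  rw [ENat.card_coe_set_eq] at h1_le mgs_le
  exact ⟨⟨h1_le, ENat.add_lt_top.2 ⟨hX.mgsModule_H1_lt_top A, hfin.encard_lt_top⟩⟩,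
    ⟨mgs_le, ENat.add_lt_top.2 ⟨hX.MGS_lt_top, hfin.encard_lt_top⟩⟩,
    (mgs_le_MGS _).trans mgs_le⟩

theorem theorem4p13 {X : Type u} [MetricSpace X] [CompactSpace X] (x₀ : X)
    (A : Type v) [CommRing A]
    {R : ℝ} (hR : 0 < R) (hX : RipsMin.SimplyConnectedUpTo X R)
    (hmin : (RipsMin.LocMin X).Finite)
    (hfin : ∀ c : ℝ, 0 < c → (RipsMin.minPairs X c).Finite)
    {r : ℝ} (hr : 0 < r) :
    (RipsMin.mgsModule A (RipsMin.H1 A (RipsMin.RipsSpace X r)) ≤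
        RipsMin.mgsModule A (RipsMin.H1 A X) + RipsMin.numMinEdges X hmin r ∧
      RipsMin.mgsModule A (RipsMin.H1 A X) + RipsMin.numMinEdges X hmin r < ⊤) ∧
    (RipsMin.MGS (RipsMin.RipsSpace X r) ≤ RipsMin.MGS X + RipsMin.numMinEdges X hmin r ∧
      RipsMin.MGS X + RipsMin.numMinEdges X hmin r < ⊤) ∧
    RipsMin.mgs (FundamentalGroup (RipsMin.RipsSpace X r) (RipsMin.ripsPoint X hr x₀)) ≤
      RipsMin.MGS X + RipsMin.numMinEdges X hmin r := by
  have := hX.locallyPathConnectedSpace hR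
  rw [← RipsMin.encard_minEdgesBelow hmin r]
  exact theorem4p13_general (hX.semilocallySimplyConnected hR) x₀ A hr
    (RipsMin.finite_minEdgesBelow hmin hfin r)
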